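/- For $\alpha\in\mathbb{R}$ let $\mathcal H_{\alpha}$ be the space of analytic functions on the open upper half-plane $\{z=b+ia: b\in\mathbb{R},\ a>0\}$ that are square integrable with respect to $a^{\alpha}\,da\,db$, with inner product $\langle f,g\rangle=\int f\,\overline{g}\;a^{\alpha}\,da\,db$. Let $\mathcal S_o(\mathbb R)$ be the space of odd complex-valued Schwartz functions on $\mathbb R$ and $L^2_o(\mathbb R)$ the space of odd functions in $L^2(\mathbb R)$. For $\psi\in\mathcal S_o(\mathbb R)$ and $\operatorname{Im} z>0$ put $$(A_o\psi)(z)=\frac{1}{2\pi^{3/4}}\int_{-\infty}^{\infty}p\,e^{izp^2/2}\,\psi(p)\,dp .$$ **Theorem.** The transform $A_o$ maps $\mathcal S_o(\mathbb R)$ into $\mathcal H_{-1/2}$ and satisfies $\langle A_o\varphi,A_o\psi\rangle=\int_{-\infty}^\infty\varphi(p)\overline{\psi(p)}\,dp$ for all $\varphi,\psi\in\mathcal S_o(\mathbb R)$. It has exactly one continuous linear extension $L^2_o(\mathbb R)\to\mathcal H_{-1/2}$, again denoted $A_o$, and this extension is a unitary map of $L^2_o(\mathbb R)$ onto $\mathcal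 H_{-1/2}$. Its inverse is given by $$(A_o^{-1}f)(p)=\frac{1}{2\pi^{3/4}}\lim_{\sigma,\gamma\to\infty}\int_{R_{\sigma,\gamma}}p\,e^{-i\bar z p^2/2}f(z)\,a^{-1/2}\,da\,db,\qquad R_{\sigma,\gamma}=\{z=b+ia:\ |b|<\sigma,\ 1/\gamma<a<\gamma\},$$ as $\sigma$ and $\gamma$ tend to infinity independently. For every $f\in\mathcal H_{-1/2}$ the truncated integrals are in $L^2(\mathbb R)$ as functions of $p$ (for all $\sigma,\gamma>0$) and the limit holds in the norm of $L^2(\mathbb R)$; if $f=A_o\psi$ with $\psi\in\mathcal S_o(\mathbb R)$, the limit also holds at every point $p\in\mathbb R$, with value $\psi(p)$. -/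

import Mathlib

open MeasureTheory Filter Topology Complex
open scoped SchwartzMap ComplexConjugate ENNReal

noncomputable section

/-- The measure `(Im z) ^ α da db` (with `z = b + i a`) on the open upper half-plane,
viewed as a measure on `ℂ`. -/
def halfPlaneMeasure (α : ℝ) : Measure ℂ :=
  (volume.restrict {z : ℂ | 0 < z.im}).withDensity fun z => ENNReal.ofReal (z.im ^ α)

/-- `f` is analytic on the open upper half-plane and square integrable there
with respect to `(Im z) ^ α da db`. -/
def IsBergman (α : ℝ) (f : ℂ → ℂ) : Prop :=
  DifferentiableOn ℂ f {z : ℂ | 0 < z.im} ∧ MemLp f 2 (halfPlaneMeasure α)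

/-- The weighted Bergman space `H_α` of the upper half-plane, as a subspace of `L²`, with the
inner product of `L²`. -/
def bergmanSpace (α : ℝ) : Submodule ℂ (Lp ℂ 2 (halfPlaneMeasure α)) where
  carrier := {F | ∃ f : ℂ → ℂ, IsBergman α f ∧ F =ᵐ[halfPlaneMeasure α] f}
  zero_mem' := ⟨0, ⟨differentiableOn_const 0, MemLp.zero⟩, Lp.coeFn_zero _ _ _⟩
  add_mem' := by
    rintro F G ⟨f, hf, hF⟩ ⟨g, hg, hG⟩
    exact ⟨f + g, ⟨hf.1.add hg.1, hf.2.add hg.2⟩, (Lp.coeFn_add F G).trans (hF.add hG)⟩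
  smul_mem' := by
    rintro c F ⟨f, hf, hF⟩
    exact ⟨c • f, ⟨hf.1.const_smul c, hf.2.const_smul c⟩,
      (Lp.coeFn_smul c F).trans (hF.const_smul c)⟩

/-- The element of `H_α` given by an analytic square integrable function. -/
def IsBergman.toSpace {α : ℝ} {f : ℂ → ℂ} (hf : IsBergman α f) : bergmanSpace α :=
  ⟨hf.2.toLp f, f, hf, hf.2.coeFn_toLp⟩

/-- The odd Schwartz functions on `ℝ`. -/
def oddSchwartz : Submodule ℂ 𝓢(ℝ, ℂ) where
  carrier := {ψ | ∀ p, ψ (-p) = -ψ p}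
  zero_mem' := by intro p; simp
  add_mem' := by
    intro φ ψ hφ hψ p
    simp only [add_apply, hφ p, hψ p]
    ring
  smul_mem' := by
    intro c ψ hψ p
    simp only [smul_apply, hψ p, smul_neg]

lemma ae_comp_neg {F G : ℝ → ℂ} (h : F =ᵐ[volume] G) :
    (fun p => F (-p)) =ᵐ[volume] fun p => G (-p) :=
  (Measure.measurePreserving_neg (volume : Measure ℝ)).quasiMeasurePreserving.ae_eq_comp h

/-- The odd square integrable functions on `ℝ`. -/
def oddL2 : Submodule ℂ (Lp ℂ 2 (volume : Measure ℝ)) where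
  carrier := {F | ∀ᵐ p : ℝ, F (-p) = -F p}
  zero_mem' := by
    have h := Lp.coeFn_zero ℂ 2 (volume : Measure ℝ)
    change ∀ᵐ p : ℝ, (0 : Lp ℂ 2 (volume : Measure ℝ)) (-p) = -(0 : Lp ℂ 2 (volume : Measure ℝ)) p
    filter_upwards [h, ae_comp_neg h] with p h1 h2
    rw [h1, h2]
    simp
  add_mem' := by
    intro F G hF hG
    have h := Lp.coeFn_add F G
    change ∀ᵐ p : ℝ, (F + G : Lp ℂ 2 (volume : Measure ℝ)) (-p) = -(F + G : Lp ℂ 2 (volume : Measure ℝ)) p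
    filter_upwards [h, ae_comp_neg h, hF, hG] with p h1 h2 h3 h4
    rw [h1, h2]
    simp only [Pi.add_apply, h3, h4]
    ring
  smul_mem' := by
    intro c F hF
    have h := Lp.coeFn_smul c F
    change ∀ᵐ p : ℝ, (c • F : Lp ℂ 2 (volume : Measure ℝ)) (-p) = -(c • F : Lp ℂ 2 (volume : Measure ℝ)) p
    filter_upwards [h, ae_comp_neg h, hF] with p h1 h2 h3
    rw [h1, h2]
    simp only [Pi.smul_apply, h3, smul_neg]

/-- An odd Schwartz function as an odd element of `L²(ℝ)`. -/
def oddSchwartzToL2 (ψ : oddSchwartz) : oddL2 :=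
  ⟨(ψ : 𝓢(ℝ, ℂ)).toLp 2, by
    have h := (ψ : 𝓢(ℝ, ℂ)).coeFn_toLp 2 (volume : Measure ℝ)
    filter_upwards [h, ae_comp_neg h] with p h1 h2
    rw [h1, h2]
    exact ψ.2 p⟩

/-- `(A_o ψ)(z) = (1 / (2 π^{3/4})) ∫ p e^{i z p² / 2} ψ(p) dp`. -/
def oddTransform (ψ : ℝ → ℂ) (z : ℂ) : ℂ :=
  ((1 / (2 * Real.pi ^ (3 / 4 : ℝ)) : ℝ) : ℂ) *
    ∫ p : ℝ, (p : ℂ) * Complex.exp (I * z * (p : ℂ) ^ 2 / 2) * ψ p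

/-- The truncated rectangle `|Re z| < σ`, `1/γ < Im z < γ`. -/
def truncRect (σ γ : ℝ) : Set ℂ := {z | |z.re| < σ ∧ 1 / γ < z.im ∧ z.im < γ}

/-- `(1 / (2 π^{3/4})) ∫_R p e^{-i z̄ p² / 2} f(z) a^{-1/2} da db` over the truncated rectangle
`R`, where `a = Im z`. -/
def truncInverse (f : ℂ → ℂ) (σ γ : ℝ) (p : ℝ) : ℂ :=
  ((1 / (2 * Real.pi ^ (3 / 4 : ℝ)) : ℝ) : ℂ) *
    ∫ z in truncRect σ γ, (p : ℂ) * Complex.exp (-I * conj z * (p : ℂ) ^ 2 / 2) * f z *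
      ((z.im ^ (-1 / 2 : ℝ) : ℝ) : ℂ)

end

open MeasureTheory Filter Topology Complex
open scoped SchwartzMap ComplexConjugate ENNReal

/-! For `Im w > 0` the function `k_w(p) = c p exp(-i w̄ p² / 2)` (`waveKernel`) is odd and square
integrable, and `(A g)(w) = ⟪k_w, g⟫`. The transform `A k_w` is a second moment of a complex
Gaussian, a constant times `(-i (z - w̄))^(-3/2)`. The whole theorem rests on the fact that this is
the reproducing kernel of `H_{-1/2}`: `⟪A k_w, f⟫ = f w`
(`integral_conj_oddTransform_waveKernel_mul`). To see it, move `w` to the centre of the unit disc by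
a Cayley map. Conjugated kernel, weight and Jacobian combine to a holomorphic function times the
radial weight `(1 - |ζ|²)^(-1/2)`, so the mean value property evaluates the integral.

Consequently `A` preserves inner products on the span of the `k_w`. This span is dense: if `g ⟂ k_w`
for all `w`, then `A g = 0`, and on the line `Im z = 1` this says that an even integrable function
has vanishing Fourier integrals in the variable `p²` (`oddTransform_injective`). Fatou's lemma and
continuity extend the isometry to all of `L²_o`. The reproducing property also gives `A A* f = f`
(`oddTransformIsometry_adjoint`), so `A` is onto and its inverse is `A*`.

The truncated integral is `A*` applied to `f` cut off to the rectangle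
(`adjoint_indicator_truncRect`), which gives the `L²` limit. For `f = A ψ` with `ψ` Schwartz,
`exists_norm_oddTransform_le` bounds `f` by an integrable function of `Re z`, uniformly in `Im z`.
With the factor `exp(-a p² / 2)` this permits dominated convergence for `p ≠ 0`; the limit is
continuous there and equals `ψ` almost everywhere, hence everywhere off `0`. -/

/-- The normalising constant `1 / (2 π^{3/4})` of the transform. -/
noncomputable def oddConst : ℝ := 1 / (2 * Real.pi ^ (3 / 4 : ℝ))

lemma oddConst_pos : 0 < oddConst := by
  unfold oddConst; positivity

lemma oddConst_sq : oddConst ^ 2 = 1 / (4 * (Real.pi * √Real.pi)) := by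
  have h : (Real.pi ^ (3 / 4 : ℝ)) ^ 2 = Real.pi * √Real.pi := by
    rw [← Real.rpow_natCast, ← Real.rpow_mul Real.pi_pos.le, Real.sqrt_eq_rpow]
    nth_rw 2 [← Real.rpow_one Real.pi]
    rw [← Real.rpow_add Real.pi_pos]
    norm_num
  unfold oddConst
  rw [div_pow, mul_pow, h]
  norm_num

/-! ### Gaussian moments and the functions representing point evaluation. -/

lemma integrable_pow_mul_exp_neg_mul_sq (n : ℕ) {b : ℝ} (hb : 0 < b) :
    Integrable fun p : ℝ => |p| ^ n * Real.exp (-b * p ^ 2) := by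
  have h := (integrable_rpow_mul_exp_neg_mul_sq hb (s := n)
    (by have : (0 : ℝ) ≤ n := n.cast_nonneg
        linarith)).norm
  refine h.congr (Eventually.of_forall fun p => ?_)
  simp only [Real.rpow_natCast, norm_mul, norm_pow, Real.norm_eq_abs, Real.abs_exp]

lemma memLp_pow_mul_exp_neg_mul_sq (n : ℕ) {b : ℝ} (hb : 0 < b) :
    MemLp (fun p : ℝ => |p| ^ n * Real.exp (-b * p ^ 2)) 2 := by
  rw [memLp_two_iff_integrable_sq (by fun_prop)]
  refine (integrable_pow_mul_exp_neg_mul_sq (n * 2) (b := b * 2) (by positivity)).congr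
    (Eventually.of_forall fun p => ?_)
  simp only [mul_pow, ← pow_mul, ← Real.exp_nat_mul]
  congr 2
  push_cast
  ring

lemma norm_exp_phase (z : ℂ) (p : ℝ) :
    ‖Complex.exp (I * z * (p : ℂ) ^ 2 / 2)‖ = Real.exp (-(z.im / 2) * p ^ 2) := by
  rw [Complex.norm_exp]
  congr 1
  rw [show I * z * (p : ℂ) ^ 2 / 2 = ((p ^ 2 / 2 : ℝ) : ℂ) * (I * z) by push_cast; ring,
    Complex.re_ofReal_mul]
  simp
  ring

/-- The function `p ↦ c p exp (-i w̄ p² / 2)` representing evaluation at `w` of the transform. -/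
noncomputable def waveKernel (w : ℂ) (p : ℝ) : ℂ :=
  (oddConst : ℂ) * ((p : ℂ) * Complex.exp (-I * conj w * (p : ℂ) ^ 2 / 2))

lemma conj_waveKernel (w : ℂ) (p : ℝ) :
    conj (waveKernel w p) = (oddConst : ℂ) * ((p : ℂ) * Complex.exp (I * w * (p : ℂ) ^ 2 / 2)) := by
  simp only [waveKernel, map_mul, Complex.conj_ofReal, ← Complex.exp_conj, map_div₀, map_neg,
    Complex.conj_I, Complex.conj_conj, map_pow, neg_neg]
  congr 4
  exact Complex.conj_ofReal 2

lemma norm_waveKernel (w : ℂ) (p : ℝ) :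
    ‖waveKernel w p‖ = oddConst * (|p| * Real.exp (-(w.im / 2) * p ^ 2)) := by
  rw [← RCLike.norm_conj, conj_waveKernel, norm_mul, norm_mul, norm_exp_phase, Complex.norm_real,
    Complex.norm_real, Real.norm_eq_abs, Real.norm_eq_abs, abs_of_pos oddConst_pos]

lemma waveKernel_neg (w : ℂ) (p : ℝ) : waveKernel w (-p) = -waveKernel w p := by
  simp [waveKernel]

lemma continuous_waveKernel_uncurry : Continuous fun x : ℂ × ℝ => waveKernel x.1 x.2 := by
  unfold waveKernel
  fun_prop

lemma continuous_waveKernel (w : ℂ) : Continuous (waveKernel w) := by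
  unfold waveKernel
  fun_prop

lemma memLp_waveKernel {w : ℂ} (hw : 0 < w.im) : MemLp (waveKernel w) 2 := by
  refine ((memLp_pow_mul_exp_neg_mul_sq 1 (half_pos hw)).const_mul oddConst).mono'
    (continuous_waveKernel w).aestronglyMeasurable (Eventually.of_forall fun p => ?_)
  rw [norm_waveKernel, pow_one]

lemma oddTransform_eq_integral_waveKernel (g : ℝ → ℂ) (z : ℂ) :
    oddTransform g z = ∫ p, conj (waveKernel z p) * g p := by
  simp only [oddTransform, conj_waveKernel, mul_assoc]
  rw [integral_const_mul]
  rfl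

lemma integrable_conj_waveKernel_mul {g : ℝ → ℂ} (hg : MemLp g 2) {z : ℂ} (hz : 0 < z.im) :
    Integrable fun p => conj (waveKernel z p) * g p :=
  (memLp_waveKernel hz).star.integrable_mul hg

lemma oddTransform_congr_ae {g h : ℝ → ℂ} (hgh : g =ᵐ[volume] h) (z : ℂ) :
    oddTransform g z = oddTransform h z := by
  rw [oddTransform_eq_integral_waveKernel, oddTransform_eq_integral_waveKernel]
  refine integral_congr_ae ?_
  filter_upwards [hgh] with p hp
  rw [hp]

/-- The function representing evaluation at `w`, as an element of `L²(ℝ)`. -/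
noncomputable def waveL2 {w : ℂ} (hw : 0 < w.im) : oddL2 :=
  ⟨(memLp_waveKernel hw).toLp _, by
    have h := (memLp_waveKernel hw).coeFn_toLp
    filter_upwards [h, ae_comp_neg h] with p h1 h2
    rw [h1, h2]
    exact waveKernel_neg w p⟩

/-- Point evaluation of the transform is a bounded functional on `L²`, so `L²` convergence of `g`
forces pointwise convergence of its transform. -/
lemma inner_waveL2 {w : ℂ} (hw : 0 < w.im) (g : oddL2) :
    inner ℂ (waveL2 hw) g = oddTransform ((g : Lp ℂ 2 (volume : Measure ℝ)) : ℝ → ℂ) w := by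
  rw [Submodule.coe_inner, L2.inner_def, oddTransform_eq_integral_waveKernel]
  refine integral_congr_ae ?_
  filter_upwards [(memLp_waveKernel hw).coeFn_toLp] with p hp
  simp only [waveL2, hp, RCLike.inner_apply, mul_comm]

lemma isOpen_upperHalfPlane : IsOpen {z : ℂ | 0 < z.im} :=
  isOpen_lt continuous_const Complex.continuous_im

theorem differentiableOn_oddTransform {g : ℝ → ℂ} (hg : MemLp g 2) :
    DifferentiableOn ℂ (oddTransform g) {z : ℂ | 0 < z.im} := by
  intro z₀ hz₀
  have hz₀ : 0 < z₀.im := hz₀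
  refine DifferentiableAt.differentiableWithinAt ?_
  unfold oddTransform
  refine DifferentiableAt.const_mul ?_ _
  let F' : ℂ → ℝ → ℂ := fun z p =>
    (p : ℂ) * (Complex.exp (I * z * (p : ℂ) ^ 2 / 2) * (I * (p : ℂ) ^ 2 / 2)) * g p
  -- Staying above half the height of `z₀` gives one Gaussian, `exp(-(z₀.im / 4) p²)`, that
  -- dominates all the derivatives in `z`.
  have hs : {z : ℂ | z₀.im / 2 < z.im} ∈ 𝓝 z₀ :=
    (isOpen_lt continuous_const Complex.continuous_im).mem_nhds (half_lt_self hz₀)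
  have hmeas : ∀ z : ℂ, AEStronglyMeasurable
      (fun p : ℝ => (p : ℂ) * Complex.exp (I * z * (p : ℂ) ^ 2 / 2) * g p) volume := fun z =>
    AEStronglyMeasurable.mul (by fun_prop) hg.1
  refine (hasDerivAt_integral_of_dominated_loc_of_deriv_le (F' := F') hs
    (bound := fun p => |p| ^ 3 * Real.exp (-(z₀.im / 4) * p ^ 2) * ‖g p‖)
    (Eventually.of_forall hmeas) ?_ ?_ ?_ ?_ ?_).2.differentiableAt
  · have h := (integrable_conj_waveKernel_mul hg hz₀).const_mul ((oddConst : ℂ)⁻¹)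
    refine h.congr (Eventually.of_forall fun p => ?_)
    have : (oddConst : ℂ) ≠ 0 := by exact_mod_cast oddConst_pos.ne'
    simp only [conj_waveKernel]
    field_simp
  · exact AEStronglyMeasurable.mul (by fun_prop) hg.1
  · refine Eventually.of_forall fun p z hz => ?_
    simp only [F', norm_mul, norm_exp_phase, norm_div, norm_pow, Complex.norm_I, Complex.norm_real,
      Real.norm_eq_abs, one_mul, Complex.norm_ofNat]
    have hz : z₀.im / 2 < z.im := hz
    have h1 : Real.exp (-(z.im / 2) * p ^ 2) ≤ Real.exp (-(z₀.im / 4) * p ^ 2) := by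
      apply Real.exp_le_exp.2
      nlinarith [sq_nonneg p]
    refine mul_le_mul_of_nonneg_right ?_ (norm_nonneg _)
    calc |p| * (Real.exp (-(z.im / 2) * p ^ 2) * (|p| ^ 2 / 2))
        = |p| ^ 3 * Real.exp (-(z.im / 2) * p ^ 2) / 2 := by ring
      _ ≤ |p| ^ 3 * Real.exp (-(z.im / 2) * p ^ 2) := half_le_self (by positivity)
      _ ≤ _ := by gcongr
  · exact (memLp_pow_mul_exp_neg_mul_sq 3 (by positivity)).integrable_mul hg.norm
  · refine Eventually.of_forall fun p z _ => ?_
    have h : HasDerivAt (fun z : ℂ => I * z * (p : ℂ) ^ 2 / 2) (I * (p : ℂ) ^ 2 / 2) z := by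
      have := (((hasDerivAt_id z).const_mul I).mul_const ((p : ℂ) ^ 2)).div_const 2
      simpa using this
    exact (h.cexp.const_mul (p : ℂ)).mul_const (g p)

/-- The second moment of a complex Gaussian. -/
theorem integral_sq_mul_cexp_neg_mul_sq {b : ℂ} (hb : 0 < b.re) :
    ∫ p : ℝ, (p : ℂ) ^ 2 * Complex.exp (-b * (p : ℂ) ^ 2) =
      (Real.pi / b : ℂ) ^ (1 / 2 : ℂ) / (2 * b) := by
  have hint : ∀ n : ℕ, Integrable fun p : ℝ => (p : ℂ) ^ n * Complex.exp (-b * (p : ℂ) ^ 2) := by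
    intro n
    refine (integrable_pow_mul_exp_neg_mul_sq n hb).mono' (by fun_prop)
      (Eventually.of_forall fun p => ?_)
    rw [norm_mul, norm_cexp_neg_mul_sq, norm_pow, Complex.norm_real, Real.norm_eq_abs]
  have hb0 : b ≠ 0 := by rintro rfl; simp at hb
  -- The integral of the derivative of `p exp(-b p²)` vanishes, which reduces the second moment to
  -- the zeroth.
  have hderiv : ∀ p : ℝ, HasDerivAt (fun p : ℝ => (p : ℂ) ^ 1 * Complex.exp (-b * (p : ℂ) ^ 2))
      ((p : ℂ) ^ 0 * Complex.exp (-b * (p : ℂ) ^ 2) -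
        2 * b * ((p : ℂ) ^ 2 * Complex.exp (-b * (p : ℂ) ^ 2))) p := by
    intro p
    have h1 : HasDerivAt (fun z : ℂ => z ^ 1 * Complex.exp (-b * z ^ 2))
        ((p : ℂ) ^ 0 * Complex.exp (-b * (p : ℂ) ^ 2) -
        2 * b * ((p : ℂ) ^ 2 * Complex.exp (-b * (p : ℂ) ^ 2))) p := by
      have := (hasDerivAt_pow 1 (p : ℂ)).mul (((hasDerivAt_pow 2 (p : ℂ)).const_mul (-b)).cexp)
      refine this.congr_deriv ?_
      push_cast
      ring
    exact h1.comp_ofReal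
  have h0 := integral_eq_zero_of_hasDerivAt_of_integrable hderiv
    ((hint 0).sub ((hint 2).const_mul _)) (hint 1)
  rw [integral_sub (hint 0) ((hint 2).const_mul _), integral_const_mul, sub_eq_zero] at h0
  rw [eq_div_iff (by simpa using hb0), mul_comm, ← h0, ← integral_gaussian_complex hb]
  simp

lemma re_phase_pos {z w : ℂ} (hz : 0 < z.im) (hw : 0 < w.im) : 0 < (-I * (z - conj w) / 2).re := by
  simp
  linarith

/-- The two phases multiply to one Gaussian with parameter `b = -i (z - w̄) / 2`, whose real part is
`(Im z + Im w) / 2`. -/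
theorem oddTransform_waveKernel {z w : ℂ} (hz : 0 < z.im) (hw : 0 < w.im) :
    oddTransform (waveKernel w) z = (oddConst : ℂ) ^ 2 *
      ((Real.pi / (-I * (z - conj w) / 2) : ℂ) ^ (1 / 2 : ℂ) / (2 * (-I * (z - conj w) / 2))) := by
  rw [oddTransform_eq_integral_waveKernel, ← integral_sq_mul_cexp_neg_mul_sq (re_phase_pos hz hw),
    ← integral_const_mul]
  congr 1
  ext p
  rw [conj_waveKernel, waveKernel, show -(-I * (z - conj w) / 2) * (p : ℂ) ^ 2 =
    I * z * (p : ℂ) ^ 2 / 2 + -I * conj w * (p : ℂ) ^ 2 / 2 by ring, Complex.exp_add]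
  ring

/-! ### The weighted measure on the half-plane. -/

lemma rpow_neg_one_half {a : ℝ} (ha : 0 ≤ a) : a ^ (-1 / 2 : ℝ) = (√a)⁻¹ := by
  rw [show (-1 / 2 : ℝ) = -(1 / 2) by norm_num, Real.rpow_neg ha, Real.sqrt_eq_rpow]

lemma measurableSet_upperHalfPlane : MeasurableSet {z : ℂ | 0 < z.im} :=
  isOpen_upperHalfPlane.measurableSet

section HalfPlaneMeasure

variable {E : Type*} [NormedAddCommGroup E] [NormedSpace ℝ E]

lemma measurable_ofReal_im_rpow (α : ℝ) :
    Measurable fun z : ℂ => ENNReal.ofReal (z.im ^ α) :=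
  (Complex.measurable_im.pow_const α).ennreal_ofReal

lemma integral_halfPlaneMeasure (α : ℝ) (F : ℂ → E) :
    ∫ z, F z ∂(halfPlaneMeasure α) = ∫ z in {z : ℂ | 0 < z.im}, (z.im ^ α) • F z := by
  rw [halfPlaneMeasure, integral_withDensity_eq_integral_toReal_smul (measurable_ofReal_im_rpow α)
    (ae_of_all _ fun _ => ENNReal.ofReal_lt_top)]
  refine setIntegral_congr_fun measurableSet_upperHalfPlane fun z hz => ?_
  rw [ENNReal.toReal_ofReal (Real.rpow_nonneg (le_of_lt hz) _)]

lemma integrable_halfPlaneMeasure_iff (α : ℝ) (F : ℂ → E) :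
    Integrable F (halfPlaneMeasure α) ↔
      IntegrableOn (fun z => (z.im ^ α) • F z) {z : ℂ | 0 < z.im} := by
  rw [halfPlaneMeasure, integrable_withDensity_iff_integrable_smul' (measurable_ofReal_im_rpow α)
    (ae_of_all _ fun _ => ENNReal.ofReal_lt_top)]
  refine integrableOn_congr_fun (fun z hz => ?_) measurableSet_upperHalfPlane
  rw [ENNReal.toReal_ofReal (Real.rpow_nonneg (le_of_lt hz) _)]

lemma ae_halfPlaneMeasure_im_pos (α : ℝ) : ∀ᵐ z ∂(halfPlaneMeasure α), 0 < z.im :=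
  (withDensity_absolutelyContinuous _ _).ae_le (ae_restrict_mem measurableSet_upperHalfPlane)

lemma ContinuousOn.aestronglyMeasurable_halfPlaneMeasure {f : ℂ → ℂ} (α : ℝ)
    (hf : ContinuousOn f {z : ℂ | 0 < z.im}) : AEStronglyMeasurable f (halfPlaneMeasure α) :=
  (hf.aestronglyMeasurable measurableSet_upperHalfPlane).mono_ac
    (withDensity_absolutelyContinuous _ _)

end HalfPlaneMeasure

/-! ### Polar coordinates and the mean value property on the disc. -/

section Polar

/-- The polar coordinates of the punctured slit unit disc. -/
def discRect : Set (ℝ × ℝ) := Set.Ioo 0 1 ×ˢ Set.Ioo (-Real.pi) Real.pi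

lemma measurableSet_discRect : MeasurableSet discRect :=
  measurableSet_Ioo.prod measurableSet_Ioo

lemma polarCoord_symm_mem_ball_iff {p : ℝ × ℝ} (hp : p ∈ polarCoord.target) :
    Complex.polarCoord.symm p ∈ Metric.ball (0 : ℂ) 1 ↔ p ∈ discRect := by
  have h1 : 0 < p.1 := hp.1
  rw [mem_ball_zero_iff, Complex.norm_polarCoord_symm, abs_of_pos h1]
  exact ⟨fun h => ⟨⟨h1, h⟩, hp.2⟩, fun h => h.1.2⟩

lemma discRect_subset_target : discRect ⊆ polarCoord.target :=
  fun _ hp => ⟨hp.1.1, hp.2⟩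

lemma setLIntegral_ball_polar (f : ℂ → ℝ≥0∞) :
    ∫⁻ z in Metric.ball (0 : ℂ) 1, f z =
      ∫⁻ p in discRect, ENNReal.ofReal p.1 * f (Complex.polarCoord.symm p) := by
  rw [← lintegral_indicator Metric.isOpen_ball.measurableSet,
    ← Complex.lintegral_comp_polarCoord_symm]
  have : discRect = discRect ∩ polarCoord.target :=
    (Set.inter_eq_left.2 discRect_subset_target).symm
  rw [this, ← setLIntegral_indicator measurableSet_discRect]
  refine setLIntegral_congr_fun polarCoord.open_target.measurableSet fun p hp => ?_
  by_cases h : p ∈ discRect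
  · rw [Set.indicator_of_mem ((polarCoord_symm_mem_ball_iff hp).2 h), Set.indicator_of_mem h,
      smul_eq_mul]
  · rw [Set.indicator_of_notMem h,
      Set.indicator_of_notMem (fun h' => h ((polarCoord_symm_mem_ball_iff hp).1 h'))]
    simp

lemma setIntegral_ball_polar (f : ℂ → ℂ) :
    ∫ z in Metric.ball (0 : ℂ) 1, f z =
      ∫ p in discRect, p.1 • f (Complex.polarCoord.symm p) := by
  rw [← integral_indicator Metric.isOpen_ball.measurableSet,
    ← Complex.integral_comp_polarCoord_symm]
  have : discRect = polarCoord.target ∩ discRect :=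
    (Set.inter_eq_right.2 discRect_subset_target).symm
  rw [this, ← setIntegral_indicator measurableSet_discRect]
  refine setIntegral_congr_fun polarCoord.open_target.measurableSet fun p hp => ?_
  by_cases h : p ∈ discRect
  · rw [Set.indicator_of_mem ((polarCoord_symm_mem_ball_iff hp).2 h), Set.indicator_of_mem h]
  · rw [Set.indicator_of_notMem h,
      Set.indicator_of_notMem (fun h' => h ((polarCoord_symm_mem_ball_iff hp).1 h'))]
    simp

lemma Complex.continuous_polarCoord_symm : Continuous fun p : ℝ × ℝ => Complex.polarCoord.symm p := by
  simp only [Complex.polarCoord_symm_apply]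
  fun_prop

/-- Supplies the integrability that Fubini needs in polar coordinates. Continuity settles
measurability, and the polar formula for lower integrals matches the integrals of the norms. -/
lemma integrableOn_ball_iff_polar {f : ℂ → ℂ} (hf : ContinuousOn f (Metric.ball 0 1)) :
    IntegrableOn f (Metric.ball (0 : ℂ) 1) ↔
      IntegrableOn (fun p : ℝ × ℝ => p.1 • f (Complex.polarCoord.symm p)) discRect := by
  have hm1 : AEStronglyMeasurable f (volume.restrict (Metric.ball 0 1)) :=
    hf.aestronglyMeasurable Metric.isOpen_ball.measurableSet
  have hm2 : AEStronglyMeasurable (fun p : ℝ × ℝ => p.1 • f (Complex.polarCoord.symm p))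
      (volume.restrict discRect) := by
    refine ContinuousOn.aestronglyMeasurable ?_ measurableSet_discRect
    exact continuous_fst.continuousOn.smul (hf.comp Complex.continuous_polarCoord_symm.continuousOn
      fun p hp => (polarCoord_symm_mem_ball_iff (discRect_subset_target hp)).2 hp)
  rw [IntegrableOn, IntegrableOn, Integrable, Integrable, and_iff_right hm1, and_iff_right hm2,
    HasFiniteIntegral, HasFiniteIntegral, setLIntegral_ball_polar]
  have : ∫⁻ p in discRect, ENNReal.ofReal p.1 * ‖f (Complex.polarCoord.symm p)‖ₑ =
      ∫⁻ p in discRect, ‖p.1 • f (Complex.polarCoord.symm p)‖ₑ := by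
    refine setLIntegral_congr_fun measurableSet_discRect fun p hp => ?_
    have : 0 < p.1 := hp.1.1
    simp only [enorm_smul]
    rw [Real.enorm_of_nonneg this.le]
  rw [this]

lemma integral_circle_of_differentiableOn {G : ℂ → ℂ} (hG : DifferentiableOn ℂ G (Metric.ball 0 1))
    {r : ℝ} (hr : r ∈ Set.Ioo (0 : ℝ) 1) :
    ∫ θ in Set.Ioo (-Real.pi) Real.pi, G (Complex.polarCoord.symm (r, θ)) =
      2 * Real.pi * G 0 := by
  have hd : DiffContOnCl ℂ G (Metric.ball 0 |r|) := by
    refine DifferentiableOn.diffContOnCl (hG.mono ?_)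
    rw [abs_of_pos hr.1]
    exact Metric.closure_ball_subset_closedBall.trans (Metric.closedBall_subset_ball hr.2)
  have h := hd.circleAverage
  -- The circle is started at `-π` to match the angular range of polar coordinates.
  rw [Real.circleAverage_eq_integral_add (-Real.pi)] at h
  have h2 : ∫ θ in (0 : ℝ)..2 * Real.pi, G (circleMap 0 r (θ + -Real.pi)) =
      ∫ θ in Set.Ioo (-Real.pi) Real.pi, G (Complex.polarCoord.symm (r, θ)) := by
    rw [intervalIntegral.integral_comp_add_right (fun θ => G (circleMap 0 r θ)),
      intervalIntegral.integral_of_le (by linarith [Real.pi_pos]), integral_Ioc_eq_integral_Ioo,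
      zero_add, show 2 * Real.pi + -Real.pi = Real.pi by ring]
    congr 1
    ext θ
    rw [Complex.polarCoord_symm_apply, circleMap, Complex.exp_mul_I]
    simp
  rw [h2, inv_smul_eq_iff₀ (by positivity)] at h
  rw [h, Complex.real_smul]
  push_cast
  ring

/-- The mean value property integrated against a radial weight on the unit disc. -/
theorem setIntegral_ball_radial_mul {G : ℂ → ℂ} (hG : DifferentiableOn ℂ G (Metric.ball 0 1))
    {ρ : ℝ → ℝ} (hρ : ContinuousOn ρ (Set.Ico 0 1))
    (hint : IntegrableOn (fun ζ => (ρ ‖ζ‖ : ℂ) * G ζ) (Metric.ball (0 : ℂ) 1)) :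
    ∫ ζ in Metric.ball (0 : ℂ) 1, (ρ ‖ζ‖ : ℂ) * G ζ =
      ((∫ r in Set.Ioo (0 : ℝ) 1, r * ρ r : ℝ) : ℂ) * (2 * Real.pi * G 0) := by
  have hc : ContinuousOn (fun ζ => (ρ ‖ζ‖ : ℂ) * G ζ) (Metric.ball (0 : ℂ) 1) := by
    refine ContinuousOn.mul ?_ hG.continuousOn
    exact Complex.continuous_ofReal.comp_continuousOn
      (hρ.comp continuous_norm.continuousOn fun ζ hζ => ⟨norm_nonneg _, mem_ball_zero_iff.1 hζ⟩)
  have hint' := (integrableOn_ball_iff_polar hc).1 hint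
  rw [setIntegral_ball_polar, discRect, Measure.volume_eq_prod, setIntegral_prod]
  · rw [← integral_complex_ofReal, ← integral_mul_const]
    refine setIntegral_congr_fun measurableSet_Ioo fun r hr => ?_
    simp only [Complex.norm_polarCoord_symm, abs_of_pos hr.1, Complex.real_smul]
    rw [integral_const_mul, integral_const_mul, integral_circle_of_differentiableOn hG hr]
    push_cast
    ring
  · rwa [discRect, Measure.volume_eq_prod] at hint'

lemma one_sub_sq_pos {r : ℝ} (hr : r ∈ Set.Ico (0 : ℝ) 1) : 0 < 1 - r ^ 2 := by
  nlinarith [hr.1, hr.2]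

lemma hasDerivAt_neg_sqrt_one_sub_sq {r : ℝ} (hr : r ∈ Set.Ioo (0 : ℝ) 1) :
    HasDerivAt (fun r : ℝ => -√(1 - r ^ 2)) (r * (√(1 - r ^ 2))⁻¹) r := by
  have h0 : 0 < 1 - r ^ 2 := one_sub_sq_pos ⟨hr.1.le, hr.2⟩
  have h := (((hasDerivAt_pow 2 r).const_sub 1).sqrt h0.ne').neg
  refine h.congr_deriv ?_
  have : √(1 - r ^ 2) ≠ 0 := (Real.sqrt_pos.2 h0).ne'
  field_simp
  norm_num

/-- The integrand blows up at `1`, but it is the nonnegative derivative of `-√(1 - r²)`, which is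
continuous up to the endpoint. -/
lemma integrableOn_mul_inv_sqrt_one_sub_sq :
    IntegrableOn (fun r : ℝ => r * (√(1 - r ^ 2))⁻¹) (Set.Ioo 0 1) :=
  (intervalIntegral.integrableOn_deriv_of_nonneg (by fun_prop)
    (fun _ hr => hasDerivAt_neg_sqrt_one_sub_sq hr)
    fun r hr => mul_nonneg hr.1.le (by positivity)).mono_set Set.Ioo_subset_Ioc_self

lemma integral_mul_inv_sqrt_one_sub_sq :
    ∫ r in Set.Ioo (0 : ℝ) 1, r * (√(1 - r ^ 2))⁻¹ = 1 := by
  have h := intervalIntegral.integral_eq_sub_of_hasDerivAt_of_le (a := 0) (b := 1) zero_le_one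
    (f := fun r : ℝ => -√(1 - r ^ 2)) (by fun_prop) (fun _ hr => hasDerivAt_neg_sqrt_one_sub_sq hr)
    ((intervalIntegrable_iff_integrableOn_Ioo_of_le zero_le_one).2
      integrableOn_mul_inv_sqrt_one_sub_sq)
  rw [intervalIntegral.integral_of_le zero_le_one, integral_Ioc_eq_integral_Ioo] at h
  simpa using h

lemma continuousOn_inv_sqrt_one_sub_sq :
    ContinuousOn (fun r : ℝ => (√(1 - r ^ 2))⁻¹) (Set.Ico 0 1) :=
  ContinuousOn.inv₀ (by fun_prop) fun _ hr => (Real.sqrt_pos.2 (one_sub_sq_pos hr)).ne'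

lemma integrableOn_ball_inv_sqrt_one_sub_sq :
    IntegrableOn (fun ζ : ℂ => (((√(1 - ‖ζ‖ ^ 2))⁻¹ : ℝ) : ℂ)) (Metric.ball 0 1) := by
  rw [integrableOn_ball_iff_polar]
  · rw [discRect, Measure.volume_eq_prod, IntegrableOn, ← Measure.prod_restrict]
    have h := Integrable.mul_prod integrableOn_mul_inv_sqrt_one_sub_sq
      (integrableOn_const (μ := volume) (s := Set.Ioo (-Real.pi) Real.pi) (C := (1 : ℝ)) (by simp))
    refine (h.ofReal (𝕜 := ℂ)).congr (Eventually.of_forall fun p => ?_)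
    simp
  · exact Complex.continuous_ofReal.comp_continuousOn (continuousOn_inv_sqrt_one_sub_sq.comp
      continuous_norm.continuousOn fun ζ hζ => ⟨norm_nonneg _, mem_ball_zero_iff.1 hζ⟩)

end Polar

/-! ### The Cayley map from the disc to the half-plane. -/

section Cayley

/-- The Möbius map sending the unit disc onto the upper half-plane and `0` to `w`. -/
noncomputable def cayley (w ζ : ℂ) : ℂ := conj w + 2 * I * w.im / (1 - ζ)

lemma one_sub_ne_zero_of_mem_ball {ζ : ℂ} (hζ : ζ ∈ Metric.ball (0 : ℂ) 1) : 1 - ζ ≠ 0 := by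
  rw [sub_ne_zero]
  rintro rfl
  simp at hζ

lemma cayley_zero (w : ℂ) : cayley w 0 = w := by
  apply Complex.ext <;> simp [cayley]
  ring

lemma im_cayley (w : ℂ) {ζ : ℂ} (hζ : 1 - ζ ≠ 0) :
    (cayley w ζ).im = w.im * (1 - ‖ζ‖ ^ 2) / ‖1 - ζ‖ ^ 2 := by
  have h0 : Complex.normSq (1 - ζ) ≠ 0 := by simpa using hζ
  rw [← Complex.normSq_eq_norm_sq, ← Complex.normSq_eq_norm_sq, cayley]
  have : 2 * I * (w.im : ℂ) / (1 - ζ) = ((2 * w.im / Complex.normSq (1 - ζ) : ℝ) : ℂ) *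
      (I * conj (1 - ζ)) := by
    rw [div_eq_mul_inv, Complex.inv_def]
    push_cast
    ring
  rw [this, Complex.add_im, Complex.im_ofReal_mul, eq_div_iff h0, add_mul, mul_assoc,
    mul_comm (I * _).im, ← mul_assoc, div_mul_cancel₀ _ h0]
  simp [Complex.normSq_apply]
  ring

lemma hasDerivAt_cayley (w : ℂ) {ζ : ℂ} (hζ : 1 - ζ ≠ 0) :
    HasDerivAt (cayley w) (2 * I * w.im / (1 - ζ) ^ 2) ζ := by
  have h := (((hasDerivAt_id ζ).const_sub 1).inv hζ).const_mul (2 * I * (w.im : ℂ)) |>.const_add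
    (conj w)
  refine h.congr_deriv ?_
  simp
  ring

variable {w : ℂ} (hw : 0 < w.im)
include hw

lemma cayley_injOn : Set.InjOn (cayley w) (Metric.ball 0 1) := by
  intro ζ hζ ξ hξ h
  have h1 := one_sub_ne_zero_of_mem_ball hζ
  have h2 := one_sub_ne_zero_of_mem_ball hξ
  have h3 : (w.im : ℂ) ≠ 0 := by exact_mod_cast hw.ne'
  have h4 : 2 * I * (w.im : ℂ) ≠ 0 := mul_ne_zero (mul_ne_zero two_ne_zero I_ne_zero) h3
  simp only [cayley, add_right_inj] at h
  rw [div_eq_div_iff h1 h2, mul_right_inj' h4] at h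
  linear_combination h

lemma sub_conj_ne_zero {z : ℂ} (hz : 0 < z.im) : z - conj w ≠ 0 := by
  intro h
  have := congrArg Complex.im h
  simp at this
  linarith

lemma cayley_image_ball : cayley w '' Metric.ball 0 1 = {z : ℂ | 0 < z.im} := by
  ext z
  constructor
  · rintro ⟨ζ, hζ, rfl⟩
    have h1 := one_sub_ne_zero_of_mem_ball hζ
    change 0 < (cayley w ζ).im
    rw [im_cayley w h1]
    have := one_sub_sq_pos ⟨norm_nonneg ζ, mem_ball_zero_iff.1 hζ⟩
    have := norm_pos_iff.2 h1
    positivity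
  · intro hz
    have hz : 0 < z.im := hz
    have h0 := sub_conj_ne_zero hw hz
    have h3 : (w.im : ℂ) ≠ 0 := by exact_mod_cast hw.ne'
    have h4 : 2 * I * (w.im : ℂ) ≠ 0 := mul_ne_zero (mul_ne_zero two_ne_zero I_ne_zero) h3
    -- The preimage of `z` solves `1 - ζ = 2 i Im w / (z - w̄)`; that it lies in the disc is then
    -- read off from the formula for the imaginary part.
    have h1 : 1 - (1 - 2 * I * (w.im : ℂ) / (z - conj w)) ≠ 0 := by
      rw [sub_sub_cancel]
      exact div_ne_zero h4 h0
    have hc : cayley w (1 - 2 * I * (w.im : ℂ) / (z - conj w)) = z := by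
      rw [cayley, sub_sub_cancel, div_div_cancel₀ h4]
      ring
    refine ⟨_, ?_, hc⟩
    rw [← hc, im_cayley w h1, div_pos_iff_of_pos_right (pow_pos (norm_pos_iff.2 h1) 2),
      mul_pos_iff_of_pos_left hw] at hz
    rw [mem_ball_zero_iff]
    nlinarith [norm_nonneg (1 - 2 * I * (w.im : ℂ) / (z - conj w))]

omit hw in
lemma det_restrictScalars_toSpanSingleton (c : ℂ) :
    ((ContinuousLinearMap.toSpanSingleton ℂ c).restrictScalars ℝ).det = ‖c‖ ^ 2 := by
  simp [ContinuousLinearMap.det, LinearMap.det_restrictScalars, Algebra.norm_complex_apply,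
    Complex.normSq_eq_norm_sq]

omit hw in
lemma hasFDerivWithinAt_cayley {ζ : ℂ} (hζ : ζ ∈ Metric.ball (0 : ℂ) 1) :
    HasFDerivWithinAt (cayley w) ((ContinuousLinearMap.toSpanSingleton ℂ
      (2 * I * (w.im : ℂ) / (1 - ζ) ^ 2)).restrictScalars ℝ) (Metric.ball 0 1) ζ :=
  ((hasDerivAt_cayley w (one_sub_ne_zero_of_mem_ball hζ)).hasFDerivAt.restrictScalars
    ℝ).hasFDerivWithinAt

omit hw in
lemma abs_det_cayley (ζ : ℂ) :
    |((ContinuousLinearMap.toSpanSingleton ℂ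
      (2 * I * (w.im : ℂ) / (1 - ζ) ^ 2)).restrictScalars ℝ).det| =
      4 * w.im ^ 2 / ‖1 - ζ‖ ^ 4 := by
  rw [det_restrictScalars_toSpanSingleton, abs_of_nonneg (by positivity)]
  simp only [norm_div, norm_mul, norm_pow, Complex.norm_I, Complex.norm_real, Complex.norm_ofNat,
    Real.norm_eq_abs, div_pow, mul_pow, sq_abs]
  ring

variable {E : Type*} [NormedAddCommGroup E] [NormedSpace ℝ E]

theorem setIntegral_upperHalfPlane_cayley (F : ℂ → E) :
    ∫ z in {z : ℂ | 0 < z.im}, F z =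
      ∫ ζ in Metric.ball (0 : ℂ) 1, (4 * w.im ^ 2 / ‖1 - ζ‖ ^ 4) • F (cayley w ζ) := by
  rw [← cayley_image_ball hw, integral_image_eq_integral_abs_det_fderiv_smul volume
    Metric.isOpen_ball.measurableSet (fun ζ hζ => hasFDerivWithinAt_cayley hζ) (cayley_injOn hw)]
  simp only [abs_det_cayley]

theorem integrableOn_upperHalfPlane_cayley (F : ℂ → E) :
    IntegrableOn F {z : ℂ | 0 < z.im} ↔
      IntegrableOn (fun ζ => (4 * w.im ^ 2 / ‖1 - ζ‖ ^ 4) • F (cayley w ζ))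
        (Metric.ball (0 : ℂ) 1) := by
  rw [← cayley_image_ball hw, integrableOn_image_iff_integrableOn_abs_det_fderiv_smul volume
    Metric.isOpen_ball.measurableSet (fun ζ hζ => hasFDerivWithinAt_cayley hζ) (cayley_injOn hw)]
  simp only [abs_det_cayley]

end Cayley

/-! ### The reproducing property. -/

section Reproducing

/-- The square root occurring in the reproducing kernel, in the coordinate of the unit disc. -/
noncomputable def discRoot (w ζ : ℂ) : ℂ := (Real.pi * (1 - ζ) / w.im : ℂ) ^ (1 / 2 : ℂ)

lemma discRoot_sq (w ζ : ℂ) : discRoot w ζ ^ 2 = Real.pi * (1 - ζ) / w.im := by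
  rw [discRoot, ← Complex.cpow_nat_mul]
  simp

variable {w : ℂ} (hw : 0 < w.im)
include hw

lemma discRoot_base_re_pos {ζ : ℂ} (hζ : ζ ∈ Metric.ball (0 : ℂ) 1) :
    0 < (Real.pi * (1 - ζ) / w.im : ℂ).re := by
  have h1 : ζ.re < 1 := (Complex.re_le_norm ζ).trans_lt (mem_ball_zero_iff.1 hζ)
  rw [Complex.div_ofReal_re, Complex.re_ofReal_mul, Complex.sub_re, Complex.one_re]
  have := Real.pi_pos
  have : 0 < 1 - ζ.re := by linarith
  positivity

lemma norm_discRoot_sq (ζ : ℂ) :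
    ‖discRoot w ζ‖ ^ 2 = Real.pi * ‖1 - ζ‖ / w.im := by
  rw [← norm_pow, discRoot_sq, norm_div, norm_mul, Complex.norm_real, Complex.norm_real,
    Real.norm_of_nonneg Real.pi_pos.le, Real.norm_of_nonneg hw.le]

lemma discRoot_ne_zero {ζ : ℂ} (hζ : ζ ∈ Metric.ball (0 : ℂ) 1) : discRoot w ζ ≠ 0 := by
  intro h
  have h2 := norm_discRoot_sq hw ζ
  rw [h] at h2
  have := norm_pos_iff.2 (one_sub_ne_zero_of_mem_ball hζ)
  have := Real.pi_pos
  have : 0 < Real.pi * ‖1 - ζ‖ / w.im := by positivity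
  simp at h2
  simp_all

lemma differentiableOn_discRoot : DifferentiableOn ℂ (discRoot w) (Metric.ball 0 1) := by
  intro ζ hζ
  refine DifferentiableAt.differentiableWithinAt ?_
  unfold discRoot
  exact DifferentiableAt.cpow_const (by fun_prop) (Or.inl (discRoot_base_re_pos hw hζ))

lemma discRoot_zero : discRoot w 0 = ((√Real.pi / √w.im : ℝ) : ℂ) := by
  rw [discRoot, sub_zero, mul_one, ← Complex.ofReal_div,
    show (1 / 2 : ℂ) = ((1 / 2 : ℝ) : ℂ) by push_cast; rfl,
    ← Complex.ofReal_cpow (div_nonneg Real.pi_pos.le hw.le), ← Real.sqrt_eq_rpow,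
    Real.sqrt_div Real.pi_pos.le]

lemma im_cayley_pos {ζ : ℂ} (hζ : ζ ∈ Metric.ball (0 : ℂ) 1) : 0 < (cayley w ζ).im :=
  (cayley_image_ball hw).le ⟨ζ, hζ, rfl⟩

/-- In the disc coordinate the Gaussian parameter becomes `Im w / (1 - ζ)`. The base of the square
root thus has positive real part and the principal branch is holomorphic. -/
lemma oddTransform_waveKernel_cayley {ζ : ℂ} (hζ : ζ ∈ Metric.ball (0 : ℂ) 1) :
    oddTransform (waveKernel w) (cayley w ζ) =
      (oddConst : ℂ) ^ 2 * (discRoot w ζ * (1 - ζ) / (2 * w.im)) := by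
  have h1 := one_sub_ne_zero_of_mem_ball hζ
  have h3 : (w.im : ℂ) ≠ 0 := by exact_mod_cast hw.ne'
  have h : -I * (cayley w ζ - conj w) / 2 = w.im / (1 - ζ) := by
    rw [cayley, add_sub_cancel_left]
    linear_combination (-(w.im : ℂ) / (1 - ζ)) * Complex.I_sq
  rw [oddTransform_waveKernel (im_cayley_pos hw hζ) hw, h, discRoot, div_div_eq_mul_div]
  congr 1
  field_simp

lemma cayley_weight {ζ : ℂ} (hζ : ζ ∈ Metric.ball (0 : ℂ) 1) :
    (cayley w ζ).im ^ (-1 / 2 : ℝ) = (√w.im)⁻¹ * (√(1 - ‖ζ‖ ^ 2))⁻¹ * ‖1 - ζ‖ := by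
  rw [rpow_neg_one_half (im_cayley_pos hw hζ).le, im_cayley w (one_sub_ne_zero_of_mem_ball hζ),
    Real.sqrt_div' _ (by positivity), Real.sqrt_sq (norm_nonneg _), Real.sqrt_mul hw.le]
  field_simp

/-- The powers of `|1 - ζ|` cancel: `3` from the squared kernel, `1` from the weight, `-4` from the
Jacobian. A constant times `(1 - |ζ|²)^(-1/2)` remains. -/
theorem memLp_oddTransform_waveKernel :
    MemLp (oddTransform (waveKernel w)) 2 (halfPlaneMeasure (-1 / 2)) := by
  rw [memLp_two_iff_integrable_sq_norm
    (ContinuousOn.aestronglyMeasurable_halfPlaneMeasure _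
      (differentiableOn_oddTransform (memLp_waveKernel hw)).continuousOn),
    integrable_halfPlaneMeasure_iff, integrableOn_upperHalfPlane_cayley hw]
  refine (integrableOn_ball_inv_sqrt_one_sub_sq.re.const_mul
    (oddConst ^ 4 * Real.pi / (w.im * √w.im))).congr ?_
  filter_upwards [ae_restrict_mem Metric.isOpen_ball.measurableSet] with ζ hζ
  have h1 := norm_pos_iff.2 (one_sub_ne_zero_of_mem_ball hζ)
  have h2 := Real.sqrt_pos.2 hw
  have h3 := Real.sqrt_pos.2 (one_sub_sq_pos ⟨norm_nonneg ζ, mem_ball_zero_iff.1 hζ⟩)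
  simp only [RCLike.re_to_complex, Complex.ofReal_re, smul_eq_mul]
  rw [cayley_weight hw hζ, oddTransform_waveKernel_cayley hw hζ]
  simp only [norm_mul, norm_div, mul_pow, div_pow, norm_pow, norm_discRoot_sq hw,
    Complex.norm_real, Complex.norm_ofNat, Real.norm_of_nonneg hw.le,
    Real.norm_of_nonneg oddConst_pos.le]
  field_simp
  norm_num

/-- Pulled back to the disc, the integrand of the reproducing formula is a holomorphic function
times a radial weight. -/
lemma reproducing_integrand_cayley (f : ℂ → ℂ) {ζ : ℂ} (hζ : ζ ∈ Metric.ball (0 : ℂ) 1) :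
    (4 * w.im ^ 2 / ‖1 - ζ‖ ^ 4) • ((cayley w ζ).im ^ (-1 / 2 : ℝ) •
      (conj (oddTransform (waveKernel w) (cayley w ζ)) * f (cayley w ζ))) =
    (((√(1 - ‖ζ‖ ^ 2))⁻¹ : ℝ) : ℂ) *
      (2 * Real.pi * oddConst ^ 2 / (√w.im : ℝ) * f (cayley w ζ) / ((1 - ζ) * discRoot w ζ)) := by
  have h0 := one_sub_ne_zero_of_mem_ball hζ
  have h1 := norm_pos_iff.2 h0
  have h2 := Real.sqrt_pos.2 hw
  have h3 := Real.sqrt_pos.2 (one_sub_sq_pos ⟨norm_nonneg ζ, mem_ball_zero_iff.1 hζ⟩)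
  have hs := discRoot_ne_zero hw hζ
  rw [cayley_weight hw hζ, oddTransform_waveKernel_cayley hw hζ]
  -- Writing `conj s = |s|² / s` turns each antiholomorphic factor into a holomorphic one times a
  -- power of `|1 - ζ|`; these powers cancel against weight and Jacobian.
  have e1 : conj (discRoot w ζ) = Real.pi * ‖1 - ζ‖ / w.im / discRoot w ζ := by
    rw [eq_div_iff hs, Complex.conj_mul', ← Complex.ofReal_pow, norm_discRoot_sq hw]
    push_cast
    rfl
  have e2 : conj (1 - ζ) = (‖1 - ζ‖ : ℂ) ^ 2 / (1 - ζ) := by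
    rw [eq_div_iff h0, Complex.conj_mul']
  have e3 : conj (2 : ℂ) = 2 := Complex.conj_ofReal 2
  simp only [map_mul, map_div₀, map_pow, e1, e2, e3, Complex.conj_ofReal, Complex.real_smul]
  have h1' : (‖1 - ζ‖ : ℂ) ≠ 0 := by exact_mod_cast h1.ne'
  have h2' : ((√w.im : ℝ) : ℂ) ≠ 0 := by exact_mod_cast h2.ne'
  have h3' : ((√(1 - ‖ζ‖ ^ 2) : ℝ) : ℂ) ≠ 0 := by exact_mod_cast h3.ne'
  have h4' : (w.im : ℂ) ≠ 0 := by exact_mod_cast hw.ne'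
  push_cast
  field_simp
  ring

/-- The reproducing property: the transform of `waveKernel w` represents evaluation at `w`. -/
theorem integral_conj_oddTransform_waveKernel_mul {f : ℂ → ℂ} (hf : IsBergman (-1 / 2) f) :
    ∫ z, conj (oddTransform (waveKernel w) z) * f z ∂(halfPlaneMeasure (-1 / 2)) = f w := by
  have hint : Integrable (fun z => conj (oddTransform (waveKernel w) z) * f z)
      (halfPlaneMeasure (-1 / 2)) := (memLp_oddTransform_waveKernel hw).star.integrable_mul hf.2
  rw [integrable_halfPlaneMeasure_iff, integrableOn_upperHalfPlane_cayley hw,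
    integrableOn_congr_fun (fun ζ hζ => reproducing_integrand_cayley hw f hζ)
      Metric.isOpen_ball.measurableSet] at hint
  rw [integral_halfPlaneMeasure, setIntegral_upperHalfPlane_cayley hw,
    setIntegral_congr_fun Metric.isOpen_ball.measurableSet
      (fun ζ hζ => reproducing_integrand_cayley hw f hζ)]
  have hG : DifferentiableOn ℂ (fun ζ => 2 * Real.pi * oddConst ^ 2 / (√w.im : ℝ) *
      f (cayley w ζ) / ((1 - ζ) * discRoot w ζ)) (Metric.ball 0 1) := by
    refine DifferentiableOn.div (DifferentiableOn.const_mul ?_ _)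
      (DifferentiableOn.mul (by fun_prop) (differentiableOn_discRoot hw))
      fun ζ hζ => mul_ne_zero (one_sub_ne_zero_of_mem_ball hζ) (discRoot_ne_zero hw hζ)
    exact hf.1.comp (fun ζ hζ => (hasDerivAt_cayley w
      (one_sub_ne_zero_of_mem_ball hζ)).differentiableAt.differentiableWithinAt)
      fun ζ hζ => im_cayley_pos hw hζ
  -- The value is `2π` times the holomorphic factor at `0`, that is `4 π^(3/2) c² f w`; the
  -- normalisation of `c` makes this `f w`.
  rw [setIntegral_ball_radial_mul hG continuousOn_inv_sqrt_one_sub_sq hint,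
    integral_mul_inv_sqrt_one_sub_sq, cayley_zero, discRoot_zero hw, ← Complex.ofReal_pow,
    oddConst_sq]
  have h2' : ((√w.im : ℝ) : ℂ) ≠ 0 := by exact_mod_cast (Real.sqrt_pos.2 hw).ne'
  have h3' : ((√Real.pi : ℝ) : ℂ) ≠ 0 := by exact_mod_cast (Real.sqrt_pos.2 Real.pi_pos).ne'
  have h4' : (Real.pi : ℂ) ≠ 0 := by exact_mod_cast Real.pi_ne_zero
  have h5 : (Real.pi : ℂ) = (√Real.pi : ℝ) * (√Real.pi : ℝ) := by
    rw [← Complex.ofReal_mul, Real.mul_self_sqrt Real.pi_pos.le]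
  push_cast
  field_simp
  rw [sq ((√Real.pi : ℝ) : ℂ), ← h5]
  ring

end Reproducing

/-! ### Injectivity of the transform and density. -/

section Density

open scoped ContDiff FourierTransform

/-- Fourier inversion writes `η (p²)` as a superposition of phases `exp(-2π i v p²)`, each of which
integrates to zero against `h`. -/
lemma integral_mul_schwartz_sq_eq_zero {h : ℝ → ℂ} (hh : Integrable h)
    (h0 : ∀ b : ℝ, ∫ p, h p * Complex.exp (I * b * (p : ℂ) ^ 2 / 2) = 0) (η : 𝓢(ℝ, ℂ)) :
    ∫ p, h p * η (p ^ 2) = 0 := by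
  have hη : ∀ u : ℝ, η u = ∫ v : ℝ, Complex.exp (↑(-2 * Real.pi * v * u) * I) • (𝓕⁻ η) v := by
    intro u
    rw [← Real.fourier_real_eq_integral_exp_smul, ← SchwartzMap.fourier_coe,
      FourierTransform.fourier_fourierInv_eq]
  have hswap : ∫ p, ∫ v : ℝ, h p * (Complex.exp (((-2 * Real.pi * v * p ^ 2 : ℝ) : ℂ) * I) • (𝓕⁻ η) v) =
      ∫ v : ℝ, ∫ p, h p * (Complex.exp (((-2 * Real.pi * v * p ^ 2 : ℝ) : ℂ) * I) • (𝓕⁻ η) v) := by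
    refine integral_integral_swap ?_
    have hi := hh.mul_prod ((𝓕⁻ η).integrable (μ := volume))
    refine hi.norm.mono' (hi.1.mul (g := fun x : ℝ × ℝ =>
      Complex.exp (((-2 * Real.pi * x.2 * x.1 ^ 2 : ℝ) : ℂ) * I)) (by fun_prop) |>.congr ?_) ?_
    · refine Eventually.of_forall fun x => ?_
      simp only [Function.uncurry, smul_eq_mul, Pi.mul_apply]
      ring_nf
    · refine Eventually.of_forall fun x => ?_
      simp only [Function.uncurry, smul_eq_mul, norm_mul, Complex.norm_exp_ofReal_mul_I, one_mul,
        le_refl]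
  simp_rw [hη]
  simp_rw [← integral_const_mul]
  rw [hswap]
  refine integral_eq_zero_of_ae (Eventually.of_forall fun v => ?_)
  -- With `b = -4πv` the phase `exp(i b p² / 2)` is `exp(-2π i v p²)`.
  have := h0 (-4 * Real.pi * v)
  calc ∫ p, h p * (Complex.exp (((-2 * Real.pi * v * p ^ 2 : ℝ) : ℂ) * I) • (𝓕⁻ η) v)
      = ∫ p, h p * Complex.exp (I * ((-4 * Real.pi * v : ℝ) : ℂ) * (p : ℂ) ^ 2 / 2) * (𝓕⁻ η) v := by
        congr 1
        ext p
        rw [smul_eq_mul, ← mul_assoc]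
        congr 3
        push_cast
        ring
    _ = 0 := by rw [integral_mul_const, this, zero_mul]

lemma exists_forall_lt_eq_zero_of_tsupport_subset_Ioi {χ : ℝ → ℝ}
    (hs : tsupport χ ⊆ Set.Ioi 0) : ∃ δ > 0, ∀ x < δ, χ x = 0 := by
  have h0 : (tsupport χ)ᶜ ∈ 𝓝 (0 : ℝ) :=
    (isClosed_tsupport χ).isOpen_compl.mem_nhds fun h => lt_irrefl (0 : ℝ) (hs h)
  obtain ⟨δ, hδ, h⟩ := Metric.mem_nhds_iff.1 h0
  refine ⟨δ, hδ, fun x hx => ?_⟩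
  by_contra hne
  have hx' : x ∈ tsupport χ := subset_tsupport χ hne
  have h1 : 0 < x := hs hx'
  refine h ?_ hx'
  rw [mem_ball_zero_iff, Real.norm_of_nonneg h1.le]
  exact hx

/-- The square root fails to be smooth only at `0`, and `χ ∘ √` vanishes on a neighbourhood of every
`u ≤ 0`. -/
lemma contDiff_comp_sqrt {χ : ℝ → ℝ} (hd : ContDiff ℝ ∞ χ)
    (hs : tsupport χ ⊆ Set.Ioi 0) : ContDiff ℝ ∞ fun u => χ (√u) := by
  obtain ⟨δ, hδ, h⟩ := exists_forall_lt_eq_zero_of_tsupport_subset_Ioi hs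
  rw [contDiff_iff_contDiffAt]
  intro u
  rcases lt_or_ge 0 u with hu | hu
  · exact hd.contDiffAt.comp u (contDiffAt_id.sqrt hu.ne')
  · have : (fun u => χ (√u)) =ᶠ[𝓝 u] fun _ => 0 := by
      filter_upwards [eventually_lt_nhds (show u < δ ^ 2 by nlinarith)] with v hv
      exact h _ ((Real.sqrt_lt' hδ).2 hv)
    exact contDiffAt_const.congr_of_eventuallyEq this

lemma hasCompactSupport_comp_sqrt {χ : ℝ → ℝ} (hc : HasCompactSupport χ)
    (hs : tsupport χ ⊆ Set.Ioi 0) : HasCompactSupport fun u => χ (√u) := by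
  obtain ⟨δ, hδ, h⟩ := exists_forall_lt_eq_zero_of_tsupport_subset_Ioi hs
  refine HasCompactSupport.intro (hc.isCompact.image (continuous_pow 2)) fun u hu => ?_
  by_contra hne
  have hpos : 0 < u := by
    by_contra hle
    exact hne (h _ (by rw [Real.sqrt_eq_zero'.2 (not_lt.1 hle)]; exact hδ))
  exact hu ⟨√u, subset_tsupport χ hne, Real.sq_sqrt hpos.le⟩

/-- An even integrable function whose Gaussian phase integrals vanish is zero. -/
theorem ae_eq_zero_of_forall_integral_phase_eq_zero {h : ℝ → ℂ} (hh : Integrable h)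
    (heven : ∀ᵐ p : ℝ, h (-p) = h p)
    (h0 : ∀ b : ℝ, ∫ p, h p * Complex.exp (I * b * (p : ℂ) ^ 2 / 2) = 0) : h =ᵐ[volume] 0 := by
  have hpos : ∀ᵐ p : ℝ, p ∈ Set.Ioi (0 : ℝ) → h p = 0 := by
    refine isOpen_Ioi.ae_eq_zero_of_integral_contDiff_smul_eq_zero
      (hh.locallyIntegrable.locallyIntegrableOn _) fun χ hd hc hs => ?_
    obtain ⟨δ, hδ, hχ⟩ := exists_forall_lt_eq_zero_of_tsupport_subset_Ioi hs
    have hη : ContDiff ℝ ∞ fun u => ((χ (√u) : ℝ) : ℂ) :=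
      Complex.ofRealCLM.contDiff.comp (contDiff_comp_sqrt hd hs)
    have hη' : HasCompactSupport fun u => ((χ (√u) : ℝ) : ℂ) :=
      (hasCompactSupport_comp_sqrt hc hs).comp_left (g := Complex.ofReal) Complex.ofReal_zero
    have hz := integral_mul_schwartz_sq_eq_zero hh h0 (hη'.toSchwartzMap hη)
    have hi : Integrable fun p => χ p • h p :=
      hh.locallyIntegrable.integrable_smul_left_of_hasCompactSupport hd.continuous hc
    have hi' : Integrable fun p => χ (-p) • h (-p) := hi.comp_neg
    -- The test function `η u = χ (√u)` gives `η (p²) = χ |p| = χ p + χ (-p)`; as `h` is even, the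
    -- two halves have equal integrals.
    have hsplit : ∀ᵐ p : ℝ, h p * (hη'.toSchwartzMap hη) (p ^ 2) =
        χ p • h p + χ (-p) • h (-p) := by
      filter_upwards [heven] with p hp
      have : χ |p| = χ p + χ (-p) := by
        rcases le_total 0 p with h1 | h1
        · rw [abs_of_nonneg h1, hχ (-p) (by linarith), add_zero]
        · rw [abs_of_nonpos h1, hχ p (by linarith), zero_add]
      change h p * ((χ (√(p ^ 2)) : ℝ) : ℂ) = _
      rw [Real.sqrt_sq_eq_abs, this, hp, Complex.real_smul, Complex.real_smul]
      push_cast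
      ring
    rw [integral_congr_ae hsplit, integral_add hi hi',
      integral_neg_eq_self (fun p => χ p • h p), add_self_eq_zero] at hz
    exact hz
  have hneg : ∀ᵐ p : ℝ, -p ∈ Set.Ioi (0 : ℝ) → h (-p) = 0 :=
    (Measure.measurePreserving_neg (volume : Measure ℝ)).quasiMeasurePreserving.ae hpos
  filter_upwards [hpos, hneg, heven, (Set.countable_singleton (0 : ℝ)).ae_notMem volume]
    with p h1 h2 h3 h4
  rcases lt_trichotomy 0 p with h | h | h
  · exact h1 h
  · exact absurd h.symm h4
  · rw [← h3]
    exact h2 (neg_pos.2 h)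

/-- On the line `z = i + b` the transform is a phase integral in `p²` of the even function `conj k_i
· g`, and `k_i` vanishes only at `p = 0`. -/
theorem oddTransform_injective {g : oddL2}
    (hg : ∀ z : ℂ, 0 < z.im → oddTransform ((g : Lp ℂ 2 (volume : Measure ℝ)) : ℝ → ℂ) z = 0) :
    g = 0 := by
  have hmem := Lp.memLp (g : Lp ℂ 2 (volume : Measure ℝ))
  have hc : (oddConst : ℂ) ≠ 0 := by exact_mod_cast oddConst_pos.ne'
  have hodd : ∀ᵐ p : ℝ, (g : Lp ℂ 2 (volume : Measure ℝ)) (-p) =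
    -(g : Lp ℂ 2 (volume : Measure ℝ)) p := g.2
  have hzero := ae_eq_zero_of_forall_integral_phase_eq_zero
    (integrable_conj_waveKernel_mul hmem (z := I) (by simp)) ?_ ?_
  · apply Subtype.ext
    apply Lp.ext
    filter_upwards [hzero, Lp.coeFn_zero ℂ 2 (volume : Measure ℝ),
      (Set.countable_singleton (0 : ℝ)).ae_notMem volume] with p h1 h2 h3
    have h3 : p ≠ 0 := h3
    rw [Submodule.coe_zero, h2]
    simpa [conj_waveKernel, hc, h3] using h1
  · filter_upwards [hodd] with p hp
    rw [waveKernel_neg, hp, map_neg, neg_mul_neg]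
  · intro b
    have := hg (I + b) (by simp)
    rw [oddTransform_eq_integral_waveKernel] at this
    rw [← this]
    congr 1
    ext p
    simp only [conj_waveKernel]
    rw [show I * (I + (b : ℂ)) * (p : ℂ) ^ 2 / 2 =
      I * I * (p : ℂ) ^ 2 / 2 + I * b * (p : ℂ) ^ 2 / 2 by ring, Complex.exp_add]
    ring

/-- Oddness is the equality of two continuous maps: reflection, an isometry of `L²`, and negation.
-/
lemma isClosed_oddL2 : IsClosed (oddL2 : Set (Lp ℂ 2 (volume : Measure ℝ))) := by
  have hmp := Measure.measurePreserving_neg (volume : Measure ℝ)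
  have : (oddL2 : Set (Lp ℂ 2 (volume : Measure ℝ))) =
      {F | Lp.compMeasurePreserving (E := ℂ) (p := 2) Neg.neg hmp F = -F} := by
    ext F
    have h1 := Lp.coeFn_compMeasurePreserving F hmp
    have h2 := Lp.coeFn_neg F
    constructor
    · intro hF
      have hF : ∀ᵐ p : ℝ, F (-p) = -F p := hF
      apply Lp.ext
      filter_upwards [h1, h2, hF] with p h1 h2 h3
      rw [h1, h2]
      exact h3
    · intro hF
      have hF : Lp.compMeasurePreserving (E := ℂ) (p := 2) Neg.neg hmp F = -F := hF
      rw [hF] at h1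
      change ∀ᵐ p : ℝ, F (-p) = -F p
      filter_upwards [h1, h2] with p h1 h2
      rw [← Pi.neg_apply, ← h2, h1]
      rfl
  rw [this]
  exact isClosed_eq (Lp.isometry_compMeasurePreserving hmp).continuous continuous_neg

instance : CompleteSpace oddL2 := isClosed_oddL2.completeSpace_coe

/-- The span of the functions representing evaluations. -/
noncomputable def waveSpan : Submodule ℂ oddL2 :=
  Submodule.span ℂ {g | ∃ (w : ℂ) (hw : 0 < w.im), g = waveL2 hw}

lemma waveL2_mem_waveSpan {w : ℂ} (hw : 0 < w.im) : waveL2 hw ∈ waveSpan :=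
  Submodule.subset_span ⟨w, hw, rfl⟩

theorem dense_waveSpan : Dense (waveSpan : Set oddL2) := by
  rw [Submodule.dense_iff_topologicalClosure_eq_top, Submodule.topologicalClosure_eq_top_iff,
    Submodule.eq_bot_iff]
  intro g hg
  refine oddTransform_injective fun z hz => ?_
  rw [← inner_waveL2 hz]
  exact hg _ (waveL2_mem_waveSpan hz)

/-- Pairing an odd `g` with the odd function `χ p - χ (-p)` gives twice the integral of `χ g`, so
`g` orthogonal to odd Schwartz functions is annihilated by every test function `χ`. -/
theorem dense_span_oddSchwartz :
    Dense (Submodule.span ℂ (Set.range oddSchwartzToL2) : Set oddL2) := by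
  rw [Submodule.dense_iff_topologicalClosure_eq_top, Submodule.topologicalClosure_eq_top_iff,
    Submodule.eq_bot_iff]
  intro g hg
  have hodd : ∀ᵐ p : ℝ, (g : Lp ℂ 2 (volume : Measure ℝ)) (-p) =
    -(g : Lp ℂ 2 (volume : Measure ℝ)) p := g.2
  have hmem := Lp.memLp (g : Lp ℂ 2 (volume : Measure ℝ))
  apply Subtype.ext
  apply Lp.ext
  refine EventuallyEq.trans ?_ (Lp.coeFn_zero ℂ 2 (volume : Measure ℝ)).symm
  refine ae_eq_zero_of_integral_contDiff_smul_eq_zero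
    (hmem.locallyIntegrable one_le_two) fun χ hd hc => ?_
  have hc' : HasCompactSupport fun p => ((χ p : ℝ) : ℂ) :=
    hc.comp_left (g := Complex.ofReal) Complex.ofReal_zero
  have hd' : ContDiff ℝ ∞ fun p => ((χ p : ℝ) : ℂ) := Complex.ofRealCLM.contDiff.comp hd
  let φ : 𝓢(ℝ, ℂ) := hc'.toSchwartzMap hd'
  let φ' : 𝓢(ℝ, ℂ) := SchwartzMap.compCLMOfContinuousLinearEquiv ℂ (ContinuousLinearEquiv.neg ℝ) φ
  have hφ : ∀ p, φ p = χ p := fun p => rfl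
  have hφ' : ∀ p, φ' p = χ (-p) := fun p => rfl
  let ψ : oddSchwartz := ⟨φ - φ', fun p => by simp [hφ, hφ']⟩
  have h := hg (oddSchwartzToL2 ψ) (Submodule.subset_span ⟨ψ, rfl⟩)
  rw [Submodule.coe_inner, L2.inner_def] at h
  have hi : Integrable fun p => χ p • (g : Lp ℂ 2 (volume : Measure ℝ)) p := by
    refine ((φ.memLp 2).integrable_mul hmem).congr (Eventually.of_forall fun p => ?_)
    simp [hφ]
  have hi' := hi.comp_neg
  have hsplit : ∀ᵐ p : ℝ, inner ℂ ((oddSchwartzToL2 ψ : Lp ℂ 2 (volume : Measure ℝ)) p)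
      ((g : Lp ℂ 2 (volume : Measure ℝ)) p) =
      χ p • (g : Lp ℂ 2 (volume : Measure ℝ)) p +
        χ (-p) • (g : Lp ℂ 2 (volume : Measure ℝ)) (-p) := by
    filter_upwards [hodd, (ψ : 𝓢(ℝ, ℂ)).coeFn_toLp 2 (volume : Measure ℝ)] with p h1 h2
    have h3 : (oddSchwartzToL2 ψ : Lp ℂ 2 (volume : Measure ℝ)) p = χ p - χ (-p) := h2
    rw [h3, h1, RCLike.inner_apply]
    simp only [map_sub, Complex.conj_ofReal, Complex.real_smul]
    ring
  rw [integral_congr_ae hsplit, integral_add hi hi',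
    integral_neg_eq_self (fun p => χ p • (g : Lp ℂ 2 (volume : Measure ℝ)) p),
    add_self_eq_zero] at h
  exact h

end Density

/-! ### The isometry and its surjectivity. -/

section Isometry

local notation "μH" => halfPlaneMeasure (-1 / 2)

lemma IsBergman.congr {α : ℝ} {f g : ℂ → ℂ} (hf : IsBergman α f)
    (hfg : ∀ z : ℂ, 0 < z.im → g z = f z) : IsBergman α g :=
  ⟨hf.1.congr hfg, hf.2.ae_eq ((ae_halfPlaneMeasure_im_pos α).mono fun z hz => (hfg z hz).symm)⟩

lemma IsBergman.inner_toSpace {α : ℝ} {f g : ℂ → ℂ} (hf : IsBergman α f) (hg : IsBergman α g) :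
    inner ℂ hf.toSpace hg.toSpace = ∫ z, conj (f z) * g z ∂(halfPlaneMeasure α) := by
  rw [Submodule.coe_inner, L2.inner_def]
  refine integral_congr_ae ?_
  filter_upwards [hf.2.coeFn_toLp, hg.2.coeFn_toLp] with z h1 h2
  simp only [IsBergman.toSpace, h1, h2, RCLike.inner_apply, mul_comm]

lemma IsBergman.toSpace_eq {α : ℝ} {f g : ℂ → ℂ} (hf : IsBergman α f) (hg : IsBergman α g)
    (hfg : ∀ z : ℂ, 0 < z.im → f z = g z) : hf.toSpace = hg.toSpace :=
  Subtype.ext ((MemLp.toLp_eq_toLp_iff hf.2 hg.2).2 ((ae_halfPlaneMeasure_im_pos α).mono hfg))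

lemma exists_isBergman_toSpace_eq {α : ℝ} (F : bergmanSpace α) :
    ∃ (f : ℂ → ℂ) (hf : IsBergman α f), hf.toSpace = F := by
  obtain ⟨f, hf, hF⟩ := F.2
  refine ⟨f, hf, Subtype.ext (Lp.ext ?_)⟩
  exact hf.2.coeFn_toLp.trans hF.symm

/-- The transform of an element of `L²`, as a function on the half-plane. -/
noncomputable def oddTransformL2 (g : oddL2) : ℂ → ℂ :=
  oddTransform ((g : Lp ℂ 2 (volume : Measure ℝ)) : ℝ → ℂ)

lemma oddTransformL2_eq_inner (g : oddL2) {z : ℂ} (hz : 0 < z.im) :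
    oddTransformL2 g z = inner ℂ (waveL2 hz) g := (inner_waveL2 hz g).symm

lemma oddTransformL2_add (g h : oddL2) {z : ℂ} (hz : 0 < z.im) :
    oddTransformL2 (g + h) z = oddTransformL2 g z + oddTransformL2 h z := by
  simp only [oddTransformL2_eq_inner _ hz, inner_add_right]

lemma oddTransformL2_smul (c : ℂ) (g : oddL2) {z : ℂ} (hz : 0 < z.im) :
    oddTransformL2 (c • g) z = c * oddTransformL2 g z := by
  rw [oddTransformL2_eq_inner _ hz, oddTransformL2_eq_inner _ hz]
  exact inner_smul_right (𝕜 := ℂ) (E := oddL2) _ _ _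

lemma oddTransformL2_waveL2 {w : ℂ} (hw : 0 < w.im) (z : ℂ) :
    oddTransformL2 (waveL2 hw) z = oddTransform (waveKernel w) z :=
  oddTransform_congr_ae (memLp_waveKernel hw).coeFn_toLp z

lemma differentiableOn_oddTransformL2 (g : oddL2) :
    DifferentiableOn ℂ (oddTransformL2 g) {z : ℂ | 0 < z.im} :=
  differentiableOn_oddTransform (Lp.memLp _)

lemma isBergman_oddTransformL2_of_mem_waveSpan {g : oddL2} (hg : g ∈ waveSpan) :
    IsBergman (-1 / 2) (oddTransformL2 g) := by
  refine ⟨differentiableOn_oddTransformL2 g, ?_⟩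
  induction hg using Submodule.span_induction with
  | mem g hg =>
    obtain ⟨w, hw, rfl⟩ := hg
    exact (memLp_oddTransform_waveKernel hw).ae_eq
      (Eventually.of_forall fun z => (oddTransformL2_waveL2 hw z).symm)
  | zero =>
    refine MemLp.zero.ae_eq ((ae_halfPlaneMeasure_im_pos _).mono fun z hz => ?_)
    simp [oddTransformL2_eq_inner _ hz]
  | add g h _ _ hg hh =>
    refine (hg.add hh).ae_eq ((ae_halfPlaneMeasure_im_pos _).mono fun z hz => ?_)
    simp [oddTransformL2_add _ _ hz]
  | smul c g _ hg =>
    refine (hg.const_smul c).ae_eq ((ae_halfPlaneMeasure_im_pos _).mono fun z hz => ?_)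
    simp [oddTransformL2_smul _ _ hz]

/-- On the span of the evaluation functions the transform preserves inner products. -/
lemma integral_conj_oddTransformL2_mul {g h : oddL2} (hg : IsBergman (-1 / 2) (oddTransformL2 g))
    (hh : h ∈ waveSpan) :
    ∫ z, conj (oddTransformL2 h z) * oddTransformL2 g z ∂μH = inner ℂ h g := by
  have hint : ∀ h ∈ waveSpan,
      Integrable (fun z => conj (oddTransformL2 h z) * oddTransformL2 g z) μH := fun h hh =>
    (isBergman_oddTransformL2_of_mem_waveSpan hh).2.star.integrable_mul hg.2
  induction hh using Submodule.span_induction with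
  | mem h hh =>
    obtain ⟨w, hw, rfl⟩ := hh
    simp only [oddTransformL2_waveL2]
    rw [integral_conj_oddTransform_waveKernel_mul hw hg, oddTransformL2_eq_inner g hw]
  | zero =>
    rw [inner_zero_left]
    refine integral_eq_zero_of_ae ((ae_halfPlaneMeasure_im_pos _).mono fun z hz => ?_)
    simp [oddTransformL2_eq_inner 0 hz]
  | add h k hh hk eh ek =>
    rw [inner_add_left, ← eh, ← ek, ← integral_add (hint h hh) (hint k hk)]
    refine integral_congr_ae ((ae_halfPlaneMeasure_im_pos _).mono fun z hz => ?_)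
    simp [oddTransformL2_add _ _ hz, add_mul]
  | smul c h hh eh =>
    rw [inner_smul_left, ← eh, ← integral_const_mul]
    refine integral_congr_ae ((ae_halfPlaneMeasure_im_pos _).mono fun z hz => ?_)
    simp [oddTransformL2_smul _ _ hz, mul_assoc]

lemma IsBergman.enorm_toSpace {α : ℝ} {f : ℂ → ℂ} (hf : IsBergman α f) :
    ‖hf.toSpace‖ₑ = eLpNorm f 2 (halfPlaneMeasure α) := by
  change ‖hf.2.toLp f‖ₑ = _
  exact Lp.enorm_toLp hf.2

lemma norm_toSpace_of_mem_waveSpan {g : oddL2} (hg : g ∈ waveSpan) :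
    ‖(isBergman_oddTransformL2_of_mem_waveSpan hg).toSpace‖ = ‖g‖ := by
  have hB := isBergman_oddTransformL2_of_mem_waveSpan hg
  have h := hB.inner_toSpace hB
  rw [integral_conj_oddTransformL2_mul hB hg] at h
  have h := ((inner_self_eq_norm_sq_to_K (𝕜 := ℂ) hB.toSpace).symm.trans h).trans
    (inner_self_eq_norm_sq_to_K (𝕜 := ℂ) g)
  have h : ‖hB.toSpace‖ ^ 2 = ‖g‖ ^ 2 := by exact_mod_cast h
  exact (sq_eq_sq₀ (norm_nonneg _) (norm_nonneg _)).1 h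

lemma eLpNorm_oddTransformL2_of_mem_waveSpan {g : oddL2} (hg : g ∈ waveSpan) :
    eLpNorm (oddTransformL2 g) 2 μH = ‖g‖ₑ := by
  rw [← (isBergman_oddTransformL2_of_mem_waveSpan hg).enorm_toSpace, ← ofReal_norm, ← ofReal_norm,
    norm_toSpace_of_mem_waveSpan hg]

/-- Approximate `g` from the span of the evaluation functions. The transforms converge pointwise,
since evaluation is bounded, and Fatou's lemma bounds the limit. -/
lemma eLpNorm_oddTransformL2_le (g : oddL2) : eLpNorm (oddTransformL2 g) 2 μH ≤ ‖g‖ₑ := by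
  obtain ⟨u, hu, hlim⟩ := mem_closure_iff_seq_limit.1 (dense_waveSpan g)
  have h := Lp.eLpNorm_lim_le_liminf_eLpNorm (p := 2) (μ := μH)
    (f := fun n => oddTransformL2 (u n))
    (fun n => (isBergman_oddTransformL2_of_mem_waveSpan (hu n)).2.1) (oddTransformL2 g)
    ((ae_halfPlaneMeasure_im_pos _).mono fun z hz => by
      simp only [oddTransformL2_eq_inner _ hz]
      exact tendsto_const_nhds.inner hlim)
  simp only [eLpNorm_oddTransformL2_of_mem_waveSpan (hu _)] at h
  exact h.trans_eq (hlim.enorm.liminf_eq)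

theorem isBergman_oddTransformL2 (g : oddL2) : IsBergman (-1 / 2) (oddTransformL2 g) :=
  ⟨differentiableOn_oddTransformL2 g,
    ContinuousOn.aestronglyMeasurable_halfPlaneMeasure _
      (differentiableOn_oddTransformL2 g).continuousOn,
    (eLpNorm_oddTransformL2_le g).trans_lt enorm_lt_top⟩

/-- The transform as a linear map of `L²` spaces. -/
noncomputable def oddTransformLinear : oddL2 →ₗ[ℂ] bergmanSpace (-1 / 2) where
  toFun g := (isBergman_oddTransformL2 g).toSpace
  map_add' g h := IsBergman.toSpace_eq (isBergman_oddTransformL2 (g + h))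
    (g := oddTransformL2 g + oddTransformL2 h)
    ⟨(isBergman_oddTransformL2 g).1.add (isBergman_oddTransformL2 h).1,
      (isBergman_oddTransformL2 g).2.add (isBergman_oddTransformL2 h).2⟩
    fun _ hz => oddTransformL2_add g h hz
  map_smul' c g := IsBergman.toSpace_eq (isBergman_oddTransformL2 (c • g))
    (g := c • oddTransformL2 g)
    ⟨(isBergman_oddTransformL2 g).1.const_smul c, (isBergman_oddTransformL2 g).2.const_smul c⟩
    fun _ hz => oddTransformL2_smul c g hz

lemma norm_oddTransformLinear_le (g : oddL2) : ‖oddTransformLinear g‖ ≤ 1 * ‖g‖ := by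
  rw [one_mul, ← enorm_le_iff_norm_le]
  exact (isBergman_oddTransformL2 g).enorm_toSpace.trans_le (eLpNorm_oddTransformL2_le g)

/-- Once the transform is bounded, equality of norms is a closed condition, and it holds on the
dense span. -/
lemma norm_oddTransformLinear (g : oddL2) : ‖oddTransformLinear g‖ = ‖g‖ := by
  have hc : Continuous oddTransformLinear :=
    AddMonoidHomClass.continuous_of_bound oddTransformLinear 1 norm_oddTransformLinear_le
  have hcl : IsClosed {g : oddL2 | ‖oddTransformLinear g‖ = ‖g‖} :=
    isClosed_eq hc.norm continuous_norm
  exact hcl.closure_subset_iff.2 (fun g hg => norm_toSpace_of_mem_waveSpan hg) (dense_waveSpan g)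

/-- The transform as an isometry of `L²` spaces. -/
noncomputable def oddTransformIsometry : oddL2 →ₗᵢ[ℂ] bergmanSpace (-1 / 2) :=
  ⟨oddTransformLinear, norm_oddTransformLinear⟩

lemma oddTransformIsometry_apply (g : oddL2) :
    oddTransformIsometry g = (isBergman_oddTransformL2 g).toSpace := rfl

/-- The transform as a continuous linear map into the ambient `L²` space. -/
noncomputable def oddTransformCLM : oddL2 →L[ℂ] Lp ℂ 2 μH :=
  (bergmanSpace (-1 / 2)).subtypeL ∘L oddTransformIsometry.toContinuousLinearMap

lemma coeFn_oddTransformCLM (g : oddL2) : oddTransformCLM g =ᵐ[μH] oddTransformL2 g :=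
  (isBergman_oddTransformL2 g).2.coeFn_toLp

/-- The adjoint of the transform is a right inverse on the Bergman space. -/
theorem oddTransformIsometry_adjoint {f : ℂ → ℂ} (hf : IsBergman (-1 / 2) f) :
    oddTransformIsometry (ContinuousLinearMap.adjoint oddTransformCLM hf.toSpace) = hf.toSpace := by
  rw [oddTransformIsometry_apply]
  refine IsBergman.toSpace_eq _ hf fun w hw => ?_
  -- `(A A* f)(w) = ⟪k_w, A* f⟫ = ⟪A k_w, f⟫ = f w`.
  rw [oddTransformL2_eq_inner _ hw, ContinuousLinearMap.adjoint_inner_right,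
    ← integral_conj_oddTransform_waveKernel_mul hw hf, L2.inner_def]
  refine integral_congr_ae ?_
  filter_upwards [coeFn_oddTransformCLM (waveL2 hw), hf.2.coeFn_toLp] with z h1 h2
  simp only [IsBergman.toSpace, h1, h2, oddTransformL2_waveL2, RCLike.inner_apply, mul_comm]

/-- The unitary extension of the transform. -/
noncomputable def oddTransformEquiv : oddL2 ≃ₗᵢ[ℂ] bergmanSpace (-1 / 2) :=
  LinearIsometryEquiv.ofSurjective oddTransformIsometry fun F => by
    obtain ⟨f, hf, rfl⟩ := exists_isBergman_toSpace_eq F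
    exact ⟨_, oddTransformIsometry_adjoint hf⟩

lemma oddTransformEquiv_symm_apply {f : ℂ → ℂ} (hf : IsBergman (-1 / 2) f) :
    oddTransformEquiv.symm hf.toSpace = ContinuousLinearMap.adjoint oddTransformCLM hf.toSpace := by
  rw [LinearIsometryEquiv.symm_apply_eq]
  exact (oddTransformIsometry_adjoint hf).symm

lemma oddTransformL2_oddSchwartzToL2 (ψ : oddSchwartz) (z : ℂ) :
    oddTransformL2 (oddSchwartzToL2 ψ) z = oddTransform (ψ : 𝓢(ℝ, ℂ)) z :=
  oddTransform_congr_ae ((ψ : 𝓢(ℝ, ℂ)).coeFn_toLp 2 (volume : Measure ℝ)) z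

theorem isBergman_oddTransform (ψ : oddSchwartz) :
    IsBergman (-1 / 2) (oddTransform (ψ : 𝓢(ℝ, ℂ))) :=
  (isBergman_oddTransformL2 (oddSchwartzToL2 ψ)).congr fun z _ =>
    (oddTransformL2_oddSchwartzToL2 ψ z).symm

lemma oddTransformEquiv_oddSchwartzToL2 (ψ : oddSchwartz) :
    oddTransformEquiv (oddSchwartzToL2 ψ) = (isBergman_oddTransform ψ).toSpace :=
  IsBergman.toSpace_eq (isBergman_oddTransformL2 _) _ fun z _ => oddTransformL2_oddSchwartzToL2 ψ z

theorem integral_oddTransform_mul_conj (φ ψ : oddSchwartz) :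
    ∫ z, oddTransform (φ : 𝓢(ℝ, ℂ)) z * conj (oddTransform (ψ : 𝓢(ℝ, ℂ)) z) ∂μH =
      ∫ p : ℝ, (φ : 𝓢(ℝ, ℂ)) p * conj ((ψ : 𝓢(ℝ, ℂ)) p) := by
  -- The arguments are swapped because the inner product is conjugate-linear in its first slot.
  have h := oddTransformEquiv.inner_map_map (oddSchwartzToL2 ψ) (oddSchwartzToL2 φ)
  rw [oddTransformEquiv_oddSchwartzToL2, oddTransformEquiv_oddSchwartzToL2,
    IsBergman.inner_toSpace, Submodule.coe_inner, L2.inner_def] at h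
  simp only [mul_comm (conj _)] at h
  rw [h]
  refine integral_congr_ae ?_
  filter_upwards [(φ : 𝓢(ℝ, ℂ)).coeFn_toLp 2 (volume : Measure ℝ),
    (ψ : 𝓢(ℝ, ℂ)).coeFn_toLp 2 (volume : Measure ℝ)] with p h1 h2
  simp only [oddSchwartzToL2, h1, h2, RCLike.inner_apply]

theorem eq_oddTransformEquiv_of_eq_on_oddSchwartz (V : oddL2 →L[ℂ] bergmanSpace (-1 / 2))
    (hV : ∀ ψ : oddSchwartz, V (oddSchwartzToL2 ψ) = oddTransformEquiv (oddSchwartzToL2 ψ))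
    (g : oddL2) : V g = oddTransformEquiv g := by
  have hle : Submodule.span ℂ (Set.range oddSchwartzToL2) ≤
      LinearMap.eqLocus (V : oddL2 →ₗ[ℂ] bergmanSpace (-1 / 2))
        (oddTransformEquiv.toLinearEquiv : oddL2 →ₗ[ℂ] bergmanSpace (-1 / 2)) :=
    Submodule.span_le.2 (by rintro _ ⟨ψ, rfl⟩; exact hV ψ)
  exact (isClosed_eq V.continuous oddTransformEquiv.continuous).closure_subset_iff.2
    (fun g hg => hle hg) (dense_span_oddSchwartz g)

end Isometry

/-! ### The inversion formula in `L²`. -/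

section Inversion

local notation "μH" => halfPlaneMeasure (-1 / 2)

lemma measurableSet_truncRect (σ γ : ℝ) : MeasurableSet (truncRect σ γ) := by
  refine MeasurableSet.inter ?_ (MeasurableSet.inter ?_ ?_)
  · exact measurableSet_lt Complex.measurable_re.abs measurable_const
  · exact measurableSet_lt measurable_const Complex.measurable_im
  · exact measurableSet_lt Complex.measurable_im measurable_const

lemma truncRect_subset {σ γ : ℝ} (hγ : 0 < γ) : truncRect σ γ ⊆ {z : ℂ | 0 < z.im} :=
  fun _ hz => (one_div_pos.2 hγ).trans hz.2.1

lemma eventually_mem_truncRect {z : ℂ} (hz : 0 < z.im) :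
    ∀ᶠ s : ℝ × ℝ in atTop ×ˢ atTop, z ∈ truncRect s.1 s.2 := by
  have h1 : ∀ᶠ s : ℝ × ℝ in atTop ×ˢ atTop, |z.re| < s.1 :=
    tendsto_fst.eventually (eventually_gt_atTop _)
  have h2 : ∀ᶠ s : ℝ × ℝ in atTop ×ˢ atTop, 1 / z.im < s.2 :=
    tendsto_snd.eventually (eventually_gt_atTop _)
  have h3 : ∀ᶠ s : ℝ × ℝ in atTop ×ˢ atTop, z.im < s.2 :=
    tendsto_snd.eventually (eventually_gt_atTop _)
  filter_upwards [h1, h2, h3] with s h1 h2 h3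
  exact ⟨h1, (one_div_lt hz (hz.trans h3)).1 h2, h3⟩

lemma integrableOn_truncRect {f : ℂ → ℂ} (hf : ContinuousOn f {z : ℂ | 0 < z.im}) (α σ : ℝ) {γ : ℝ}
    (hγ : 0 < γ) : IntegrableOn (fun z => f z * ((z.im ^ α : ℝ) : ℂ)) (truncRect σ γ) := by
  have hK : IsCompact (Set.Icc (-σ) σ ×ℂ Set.Icc (1 / γ) γ) := isCompact_Icc.reProdIm isCompact_Icc
  have hsub : Set.Icc (-σ) σ ×ℂ Set.Icc (1 / γ) γ ⊆ {z : ℂ | 0 < z.im} := fun z hz =>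
    (one_div_pos.2 hγ).trans_le hz.2.1
  refine IntegrableOn.mono_set (ContinuousOn.integrableOn_compact hK ?_)
    (t := Set.Icc (-σ) σ ×ℂ Set.Icc (1 / γ) γ) fun z hz =>
      ⟨⟨(abs_lt.1 hz.1).1.le, (abs_lt.1 hz.1).2.le⟩, hz.2.1.le, hz.2.2.le⟩
  refine (hf.mono hsub).mul (Complex.continuous_ofReal.comp_continuousOn ?_)
  exact Complex.continuous_im.continuousOn.rpow_const fun z hz => Or.inl (ne_of_gt (hsub hz))

lemma truncInverse_eq (f : ℂ → ℂ) (σ γ p : ℝ) :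
    truncInverse f σ γ p =
      ∫ z in truncRect σ γ, waveKernel z p * (f z * ((z.im ^ (-1 / 2 : ℝ) : ℝ) : ℂ)) := by
  rw [truncInverse, ← integral_const_mul]
  congr 1
  ext z
  rw [waveKernel, oddConst]
  ring

lemma norm_waveKernel_le {z : ℂ} {a : ℝ} (hz : a ≤ z.im) (p : ℝ) :
    ‖waveKernel z p‖ ≤ oddConst * (|p| * Real.exp (-(a / 2) * p ^ 2)) := by
  rw [norm_waveKernel]
  have := oddConst_pos
  gcongr

variable {f : ℂ → ℂ} (hf : IsBergman (-1 / 2) f)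
include hf

/-- On the rectangle `Im z > 1 / γ`, so every kernel is dominated by the same Gaussian in `p`, while
`f` times the weight is integrable there. -/
lemma memLp_truncInverse (σ : ℝ) {γ : ℝ} (hγ : 0 < γ) :
    MemLp (truncInverse f σ γ) 2 volume := by
  have hint := integrableOn_truncRect hf.1.continuousOn (-1 / 2) σ hγ
  have hm : AEStronglyMeasurable (truncInverse f σ γ) volume := by
    have : truncInverse f σ γ = fun p => ∫ z in truncRect σ γ,
        waveKernel z p * (f z * ((z.im ^ (-1 / 2 : ℝ) : ℝ) : ℂ)) := funext (truncInverse_eq f σ γ)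
    rw [this]
    refine AEStronglyMeasurable.integral_prod_right' (f := fun x : ℝ × ℂ =>
      waveKernel x.2 x.1 * (f x.2 * ((x.2.im ^ (-1 / 2 : ℝ) : ℝ) : ℂ))) ?_
    exact (continuous_waveKernel_uncurry.comp continuous_swap).aestronglyMeasurable.mul
      hint.1.comp_snd
  refine ((memLp_pow_mul_exp_neg_mul_sq 1 (b := 1 / γ / 2) (by positivity)).const_mul
    (oddConst * ∫ z in truncRect σ γ, ‖f z * ((z.im ^ (-1 / 2 : ℝ) : ℝ) : ℂ)‖)).mono' hm
    (Eventually.of_forall fun p => ?_)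
  rw [truncInverse_eq]
  calc ‖∫ z in truncRect σ γ, waveKernel z p * (f z * ((z.im ^ (-1 / 2 : ℝ) : ℝ) : ℂ))‖
      ≤ ∫ z in truncRect σ γ, (oddConst * (|p| * Real.exp (-(1 / γ / 2) * p ^ 2))) *
          ‖f z * ((z.im ^ (-1 / 2 : ℝ) : ℝ) : ℂ)‖ := by
        refine norm_integral_le_of_norm_le (hint.norm.const_mul _) ?_
        filter_upwards [ae_restrict_mem (measurableSet_truncRect σ γ)] with z hz
        rw [norm_mul]
        exact mul_le_mul_of_nonneg_right (norm_waveKernel_le hz.2.1.le p) (norm_nonneg _)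
    _ = _ := by
        rw [integral_const_mul, pow_one]
        ring

omit hf in
lemma truncInverse_neg (f : ℂ → ℂ) (σ γ p : ℝ) :
    truncInverse f σ γ (-p) = -truncInverse f σ γ p := by
  simp only [truncInverse_eq, waveKernel_neg, neg_mul, integral_neg]

/-- The truncated inverse transform as an odd element of `L²(ℝ)`. -/
noncomputable def truncInverseL2 (σ : ℝ) {γ : ℝ} (hγ : 0 < γ) : oddL2 :=
  ⟨(memLp_truncInverse hf σ hγ).toLp _, by
    have h := (memLp_truncInverse hf σ hγ).coeFn_toLp
    filter_upwards [h, ae_comp_neg h] with p h1 h2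
    rw [h1, h2]
    exact truncInverse_neg f σ γ p⟩

lemma memLp_indicator_truncRect (s : ℝ × ℝ) :
    MemLp ((truncRect s.1 s.2).indicator f) 2 μH :=
  hf.2.indicator (measurableSet_truncRect _ _)

/-- The truncated inverse transform is the adjoint applied to the truncated function. -/
theorem adjoint_indicator_truncRect (σ : ℝ) {γ : ℝ} (hγ : 0 < γ) :
    ContinuousLinearMap.adjoint oddTransformCLM
      ((memLp_indicator_truncRect hf (σ, γ)).toLp _) = truncInverseL2 hf σ hγ := by
  refine ext_inner_left ℂ fun g => ?_
  have hg := Lp.memLp (g : Lp ℂ 2 (volume : Measure ℝ))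
  have hint := integrableOn_truncRect hf.1.continuousOn (-1 / 2) σ hγ
  rw [ContinuousLinearMap.adjoint_inner_right, L2.inner_def, Submodule.coe_inner, L2.inner_def]
  have h1 : ∫ z, inner ℂ (oddTransformCLM g z)
      ((memLp_indicator_truncRect hf (σ, γ)).toLp _ z) ∂μH =
      ∫ z in truncRect σ γ, ∫ p, waveKernel z p *
        (f z * ((z.im ^ (-1 / 2 : ℝ) : ℝ) : ℂ)) *
          conj ((g : Lp ℂ 2 (volume : Measure ℝ)) p) := by
    have e1 : ∫ z, inner ℂ (oddTransformCLM g z)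
        ((memLp_indicator_truncRect hf (σ, γ)).toLp _ z) ∂μH =
        ∫ z, (truncRect σ γ).indicator (fun z => conj (oddTransformL2 g z) * f z) z ∂μH := by
      refine integral_congr_ae ?_
      filter_upwards [coeFn_oddTransformCLM g, (memLp_indicator_truncRect hf (σ, γ)).coeFn_toLp]
        with z h1 h2
      rw [h1, h2, RCLike.inner_apply]
      by_cases hz : z ∈ truncRect σ γ
      · simp only [Set.indicator_of_mem hz, mul_comm]
      · simp only [Set.indicator_of_notMem hz, zero_mul]
    rw [e1, integral_halfPlaneMeasure]
    have e2 : ∀ z : ℂ, z.im ^ (-1 / 2 : ℝ) •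
        (truncRect σ γ).indicator (fun z => conj (oddTransformL2 g z) * f z) z =
        (truncRect σ γ).indicator
          (fun z => (z.im ^ (-1 / 2 : ℝ)) • (conj (oddTransformL2 g z) * f z)) z := fun z => by
      by_cases hz : z ∈ truncRect σ γ
      · simp only [Set.indicator_of_mem hz]
      · simp only [Set.indicator_of_notMem hz, smul_zero]
    simp only [e2]
    rw [setIntegral_indicator (measurableSet_truncRect σ γ),
      Set.inter_eq_right.2 (truncRect_subset hγ)]
    refine setIntegral_congr_fun (measurableSet_truncRect σ γ) fun z _ => ?_
    rw [oddTransformL2, oddTransform_eq_integral_waveKernel, ← integral_conj, Complex.real_smul,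
      ← integral_mul_const, ← integral_const_mul]
    congr 1
    ext p
    rw [map_mul, Complex.conj_conj]
    ring
  rw [h1, integral_integral_swap]
  · refine integral_congr_ae ?_
    filter_upwards [(memLp_truncInverse hf σ hγ).coeFn_toLp] with p hp
    simp only [truncInverseL2, hp, RCLike.inner_apply]
    rw [truncInverse_eq, integral_mul_const]
  -- Fubini applies because the lower edge of the rectangle gives a majorant that is a product of a
  -- function of `z` and a function of `p`.
  · have hb := hint.norm.mul_prod
      (((memLp_pow_mul_exp_neg_mul_sq 1 (b := 1 / γ / 2) (by positivity)).integrable_mul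
        hg.norm).const_mul oddConst)
    refine hb.mono' ?_ ?_
    · exact (continuous_waveKernel_uncurry.aestronglyMeasurable.mul hint.1.comp_fst).mul
        (hg.star.1.comp_snd)
    · have hae : ∀ᵐ x : ℂ × ℝ ∂((volume.restrict (truncRect σ γ)).prod volume),
          x.1 ∈ truncRect σ γ :=
        Measure.quasiMeasurePreserving_fst.ae (ae_restrict_mem (measurableSet_truncRect σ γ))
      filter_upwards [hae] with x hx
      have := norm_waveKernel_le hx.2.1.le x.2
      simp only [Function.uncurry, norm_mul, RCLike.norm_conj, Pi.mul_apply, pow_one]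
      calc _ ≤ oddConst * (|x.2| * Real.exp (-(1 / γ / 2) * x.2 ^ 2)) *
            (‖f x.1‖ * ‖((x.1.im ^ (-1 / 2 : ℝ) : ℝ) : ℂ)‖) *
            ‖(g : Lp ℂ 2 (volume : Measure ℝ)) x.2‖ := by gcongr
        _ = _ := by ring

lemma tendsto_indicator_truncRect :
    Tendsto (fun s : ℝ × ℝ => (memLp_indicator_truncRect hf s).toLp _) (atTop ×ˢ atTop)
      (𝓝 (hf.2.toLp f)) := by
  rw [Lp.tendsto_Lp_iff_tendsto_eLpNorm'']
  have h2 : (2 : ℝ≥0∞) ≠ 0 := two_ne_zero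
  have h2' : (2 : ℝ≥0∞) ≠ ⊤ := by simp
  simp only [eLpNorm_eq_lintegral_rpow_enorm_toReal h2 h2', ENNReal.toReal_ofNat]
  have hlim : Tendsto (fun s : ℝ × ℝ =>
      ∫⁻ z, ‖((truncRect s.1 s.2).indicator f - f) z‖ₑ ^ (2 : ℝ) ∂μH) (atTop ×ˢ atTop)
      (𝓝 (∫⁻ _, 0 ∂μH)) := by
    -- The product filter is countably generated, so sequences suffice for this independent double
    -- limit.
    refine tendsto_of_seq_tendsto fun u hu => ?_
    refine tendsto_lintegral_of_dominated_convergence' (fun z => ‖f z‖ₑ ^ (2 : ℝ)) ?_ ?_ ?_ ?_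
    · exact fun n => ((memLp_indicator_truncRect hf (u n)).sub hf.2).1.enorm.pow_const _
    · refine fun n => Eventually.of_forall fun z => ?_
      by_cases hz : z ∈ truncRect (u n).1 (u n).2
      · simp [Set.indicator_of_mem hz]
      · simp [Set.indicator_of_notMem hz]
    · exact (lintegral_rpow_enorm_lt_top_of_eLpNorm_lt_top h2 h2' hf.2.2).ne
    · filter_upwards [ae_halfPlaneMeasure_im_pos (-1 / 2)] with z hz
      refine tendsto_const_nhds.congr' ?_
      filter_upwards [hu.eventually (eventually_mem_truncRect hz)] with n hn
      simp [Set.indicator_of_mem hn]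
  rw [lintegral_zero] at hlim
  have := (ENNReal.continuous_rpow_const (y := 1 / 2)).tendsto 0 |>.comp hlim
  simpa [Function.comp_def] using this

/-- The cut-offs of `f` converge in `L²` and the adjoint is continuous. The adjoint lives on the
ambient `L²` because the cut-offs are not analytic. -/
theorem tendsto_eLpNorm_truncInverse_sub :
    Tendsto (fun s : ℝ × ℝ => eLpNorm (fun p : ℝ => truncInverse f s.1 s.2 p -
        ((oddTransformEquiv.symm hf.toSpace : Lp ℂ 2 (volume : Measure ℝ)) : ℝ → ℂ) p) 2 volume)
      (atTop ×ˢ atTop) (𝓝 0) := by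
  have h := ((ContinuousLinearMap.adjoint oddTransformCLM).continuous.tendsto _).comp
    (tendsto_indicator_truncRect hf)
  have h := (tendsto_iff_edist_tendsto_0.1 h)
  refine h.congr' ?_
  have hpos : ∀ᶠ s : ℝ × ℝ in atTop ×ˢ atTop, 0 < s.2 :=
    tendsto_snd.eventually (eventually_gt_atTop _)
  filter_upwards [hpos] with s hs
  rw [Function.comp_apply, adjoint_indicator_truncRect hf s.1 hs, oddTransformEquiv_symm_apply,
    Subtype.edist_eq, Lp.edist_def]
  refine eLpNorm_congr_ae ?_
  filter_upwards [(memLp_truncInverse hf s.1 hs).coeFn_toLp] with p hp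
  rw [Pi.sub_apply]
  congr 1

end Inversion

/-! ### Decay of transforms of Schwartz functions along horizontal lines. -/

section Decay

open scoped FourierTransform

lemma norm_cpow_half (x : ℂ) : ‖x ^ (1 / 2 : ℂ)‖ = √‖x‖ := by
  have h : (x ^ (1 / 2 : ℂ)) ^ 2 = x := by
    rw [← Complex.cpow_nat_mul]
    simp
  conv_rhs => rw [← h, norm_pow, Real.sqrt_sq (norm_nonneg _)]

lemma norm_cexp_neg_mul_sq_le_one {b : ℂ} (hb : 0 < b.re) (p : ℝ) :
    ‖Complex.exp (-b * (p : ℂ) ^ 2)‖ ≤ 1 := by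
  rw [norm_cexp_neg_mul_sq, Real.exp_le_one_iff]
  nlinarith [sq_nonneg p]

/-- The dispersive bound for a complex Gaussian integrated against a Schwartz function. -/
theorem norm_integral_gaussian_mul_schwartz_le (η : 𝓢(ℝ, ℂ)) {b : ℂ} (hb : 0 < b.re) :
    ‖∫ p : ℝ, Complex.exp (-b * (p : ℂ) ^ 2) * η p‖ ≤
      √(Real.pi / ‖b‖) * ∫ v, ‖(𝓕⁻ η) v‖ := by
  have hη : ∀ p : ℝ, η p =
      ∫ v : ℝ, Complex.exp (((-2 * Real.pi * v * p : ℝ) : ℂ) * I) • (𝓕⁻ η) v := by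
    intro u
    rw [← Real.fourier_real_eq_integral_exp_smul, ← SchwartzMap.fourier_coe,
      FourierTransform.fourier_fourierInv_eq]
  have hgauss : Integrable fun p : ℝ => Complex.exp (-b * (p : ℂ) ^ 2) :=
    integrable_cexp_neg_mul_sq hb
  have hswap : ∫ p : ℝ, ∫ v : ℝ, Complex.exp (-b * (p : ℂ) ^ 2) *
        (Complex.exp (((-2 * Real.pi * v * p : ℝ) : ℂ) * I) • (𝓕⁻ η) v) =
      ∫ v : ℝ, ∫ p : ℝ, Complex.exp (-b * (p : ℂ) ^ 2) *
        (Complex.exp (((-2 * Real.pi * v * p : ℝ) : ℂ) * I) • (𝓕⁻ η) v) := by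
    refine integral_integral_swap ?_
    have hi := hgauss.mul_prod ((𝓕⁻ η).integrable (μ := volume))
    refine hi.norm.mono' (hi.1.mul (g := fun x : ℝ × ℝ =>
      Complex.exp (((-2 * Real.pi * x.2 * x.1 : ℝ) : ℂ) * I)) (by fun_prop) |>.congr ?_) ?_
    · refine Eventually.of_forall fun x => ?_
      simp only [Function.uncurry, smul_eq_mul, Pi.mul_apply]
      ring_nf
    · refine Eventually.of_forall fun x => ?_
      simp only [Function.uncurry, smul_eq_mul, norm_mul, Complex.norm_exp_ofReal_mul_I, one_mul,
        le_refl]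
  simp_rw [hη, ← integral_const_mul]
  rw [hswap]
  refine norm_integral_le_of_norm_le ((𝓕⁻ η).integrable.norm.const_mul _)
    (Eventually.of_forall fun v => ?_)
  -- The inner integral is the Fourier transform of a Gaussian: its prefactor has modulus `√(π /
  -- |b|)`, its exponential at most `1` because `Re (1 / b) ≥ 0`.
  have hinner : ∫ p : ℝ, Complex.exp (-b * (p : ℂ) ^ 2) *
      (Complex.exp (((-2 * Real.pi * v * p : ℝ) : ℂ) * I) • (𝓕⁻ η) v) =
      (Real.pi / b) ^ (1 / 2 : ℂ) *
        Complex.exp (-((-2 * Real.pi * v : ℝ) : ℂ) ^ 2 / (4 * b)) * (𝓕⁻ η) v := by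
    rw [← fourierIntegral_gaussian hb, ← integral_mul_const]
    congr 1
    ext p
    rw [smul_eq_mul, ← mul_assoc, mul_comm (Complex.exp (-b * _))]
    congr 3
    push_cast
    ring
  rw [hinner, norm_mul, norm_mul, norm_cpow_half, norm_div, Complex.norm_real,
    Real.norm_of_nonneg Real.pi_pos.le]
  refine mul_le_mul_of_nonneg_right (mul_le_of_le_one_right (Real.sqrt_nonneg _) ?_) (norm_nonneg _)
  rw [Complex.norm_exp, Real.exp_le_one_iff]
  have : -((-2 * Real.pi * v : ℝ) : ℂ) ^ 2 / (4 * b) =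
      ((-((-2 * Real.pi * v) ^ 2 / 4) : ℝ) : ℂ) * b⁻¹ := by
    push_cast
    ring
  rw [this, Complex.re_ofReal_mul, Complex.inv_re]
  have h1 : 0 ≤ b.re / Complex.normSq b := div_nonneg hb.le (Complex.normSq_nonneg _)
  nlinarith [sq_nonneg (-2 * Real.pi * v)]

/-- Integration by parts absorbs the factor `p` and gains `1 / b`, improving the decay from
`|b|^(-1/2)` to the integrable rate `|b|^(-3/2)`. -/
lemma integral_mul_gaussian_mul_schwartz (ψ : 𝓢(ℝ, ℂ)) {b : ℂ} (hb : 0 < b.re) :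
    2 * b * ∫ p : ℝ, (p : ℂ) * Complex.exp (-b * (p : ℂ) ^ 2) * ψ p =
      ∫ p : ℝ, Complex.exp (-b * (p : ℂ) ^ 2) * SchwartzMap.derivCLM ℂ ℂ ψ p := by
  have hbdd : ∀ g : ℝ → ℂ, Integrable g →
      Integrable fun p : ℝ => Complex.exp (-b * (p : ℂ) ^ 2) * g p := fun g hg =>
    hg.bdd_mul (c := 1) (by fun_prop)
      (Eventually.of_forall fun p => norm_cexp_neg_mul_sq_le_one hb p)
  have hi0 : Integrable fun p : ℝ => (p : ℂ) * ψ p := by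
    have h := ψ.integrable_pow_mul (volume : Measure ℝ) 1
    refine h.mono' (by fun_prop) (Eventually.of_forall fun p => ?_)
    simp
  have hi1 : Integrable fun p : ℝ => (p : ℂ) * Complex.exp (-b * (p : ℂ) ^ 2) * ψ p :=
    (hbdd _ hi0).congr (Eventually.of_forall fun p => by ring)
  have hi2 := hbdd _ (SchwartzMap.derivCLM ℂ ℂ ψ).integrable
  have hderiv : ∀ p : ℝ, HasDerivAt (fun p : ℝ => Complex.exp (-b * (p : ℂ) ^ 2) * ψ p)
      (Complex.exp (-b * (p : ℂ) ^ 2) * SchwartzMap.derivCLM ℂ ℂ ψ p -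
        2 * b * ((p : ℂ) * Complex.exp (-b * (p : ℂ) ^ 2) * ψ p)) p := by
    intro p
    have h1 : HasDerivAt (fun z : ℂ => Complex.exp (-b * z ^ 2))
        (Complex.exp (-b * (p : ℂ) ^ 2) * (-b * (2 * p))) p := by
      have := ((hasDerivAt_pow 2 (p : ℂ)).const_mul (-b)).cexp
      simpa using this
    have h2 := h1.comp_ofReal.mul (ψ.differentiableAt (x := p)).hasDerivAt
    refine h2.congr_deriv ?_
    rw [SchwartzMap.derivCLM_apply]
    ring
  have h0 := integral_eq_zero_of_hasDerivAt_of_integrable hderiv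
    (hi2.sub (hi1.const_mul _)) (hbdd _ ψ.integrable)
  rw [integral_sub hi2 (hi1.const_mul _), integral_const_mul, sub_eq_zero] at h0
  exact h0.symm

lemma oddTransform_eq_gaussian (g : ℝ → ℂ) (z : ℂ) :
    oddTransform g z =
      oddConst * ∫ p : ℝ, (p : ℂ) * Complex.exp (-(-I * z / 2) * (p : ℂ) ^ 2) * g p := by
  rw [oddTransform, oddConst]
  congr 2
  ext p
  congr 3
  ring

/-- The weight `((1 + x²) / 2)^{-3/4}` dominating transforms of Schwartz functions on
horizontal lines. -/
noncomputable def decayWeight (x : ℝ) : ℝ := ((1 + x ^ 2) / 2) ^ (-(3 / 2) / 2 : ℝ)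

lemma integrable_decayWeight : Integrable decayWeight := by
  have h := integrable_rpow_neg_one_add_norm_sq (E := ℝ) (μ := volume) (r := 3 / 2)
    (by norm_num)
  refine (h.div_const ((2 : ℝ) ^ (-(3 / 2) / 2 : ℝ))).congr (Eventually.of_forall fun x => ?_)
  rw [decayWeight, Real.div_rpow (by positivity) zero_le_two]
  simp only [Real.norm_eq_abs, sq_abs]

theorem exists_norm_oddTransform_le (ψ : 𝓢(ℝ, ℂ)) :
    ∃ C, ∀ z : ℂ, 0 < z.im → ‖oddTransform ψ z‖ ≤ C * decayWeight z.re := by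
  set N : ℝ := ∫ v, ‖(𝓕⁻ (SchwartzMap.derivCLM ℂ ℂ ψ)) v‖ with hN
  have hN0 : 0 ≤ N := integral_nonneg fun _ => norm_nonneg _
  set C₁ : ℝ := oddConst * ∫ p : ℝ, ‖p‖ ^ 1 * ‖ψ p‖ with hC₁
  have hC₁0 : 0 ≤ C₁ := mul_nonneg oddConst_pos.le (integral_nonneg fun _ => by positivity)
  set C₂ : ℝ := oddConst * (√(2 * Real.pi) * N) with hC₂
  have hC₂0 : 0 ≤ C₂ := mul_nonneg oddConst_pos.le (by positivity)
  refine ⟨C₁ + C₂, fun z hz => ?_⟩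
  have hm : 0 < (1 + z.re ^ 2) / 2 := by positivity
  have hw : 0 ≤ decayWeight z.re := Real.rpow_nonneg hm.le _
  have hre : 0 < (-I * z / 2).re := by simpa using hz
  rw [oddTransform_eq_gaussian, norm_mul, Complex.norm_real, Real.norm_of_nonneg oddConst_pos.le]
  rcases le_total ((1 + z.re ^ 2) / 2) 1 with h1 | h1
  -- For `|Re z| ≤ 1` the weight is at least `1`, and the first absolute moment of `ψ` suffices.
  · have hw1 : 1 ≤ decayWeight z.re := Real.one_le_rpow_of_pos_of_le_one_of_nonpos hm h1 (by norm_num)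
    calc _ ≤ C₁ := by
          refine mul_le_mul_of_nonneg_left ?_ oddConst_pos.le
          refine norm_integral_le_of_norm_le (ψ.integrable_pow_mul volume 1)
            (Eventually.of_forall fun p => ?_)
          rw [norm_mul, norm_mul, Complex.norm_real, pow_one]
          have := norm_cexp_neg_mul_sq_le_one hre p
          exact mul_le_mul_of_nonneg_right (mul_le_of_le_one_right (norm_nonneg _) this)
            (norm_nonneg _)
      _ ≤ C₁ * decayWeight z.re := le_mul_of_one_le_right hC₁0 hw1
      _ ≤ _ := by nlinarith
  -- For `|Re z| ≥ 1` one has `|z|² ≥ (Re z)² ≥ (1 + (Re z)²) / 2`, so the dispersive rate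
  -- `|z|^(-3/2)` is below the weight.
  · have hzn : (1 + z.re ^ 2) / 2 ≤ ‖z‖ ^ 2 := by
      have := pow_le_pow_left₀ (abs_nonneg _) (Complex.abs_re_le_norm z) 2
      rw [sq_abs] at this
      linarith
    have hz0 : 0 < ‖z‖ := hz.trans_le ((le_abs_self _).trans (Complex.abs_im_le_norm z))
    have hnb : ‖-I * z / 2‖ = ‖z‖ / 2 := by simp
    have hparts := congrArg norm (integral_mul_gaussian_mul_schwartz ψ hre)
    rw [norm_mul, norm_mul, hnb, Complex.norm_ofNat, mul_div_cancel₀ _ two_ne_zero] at hparts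
    have hdisp := norm_integral_gaussian_mul_schwartz_le (SchwartzMap.derivCLM ℂ ℂ ψ) hre
    rw [← hparts, hnb, ← hN, div_div_eq_mul_div, mul_comm Real.pi, Real.sqrt_div (by positivity)]
      at hdisp
    have hpow : ‖z‖⁻¹ * (√‖z‖)⁻¹ ≤ decayWeight z.re := by
      have : ‖z‖⁻¹ * (√‖z‖)⁻¹ = (‖z‖ ^ 2) ^ (-(3 / 2) / 2 : ℝ) := by
        rw [← Real.rpow_natCast, ← Real.rpow_mul hz0.le, Real.sqrt_eq_rpow, ← Real.rpow_neg hz0.le,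
          ← Real.rpow_neg_one, ← Real.rpow_add hz0]
        norm_num
      rw [this]
      exact Real.rpow_le_rpow_of_nonpos hm hzn (by norm_num)
    calc _ ≤ oddConst * (√(2 * Real.pi) * N * (‖z‖⁻¹ * (√‖z‖)⁻¹)) := by
          refine mul_le_mul_of_nonneg_left ?_ oddConst_pos.le
          rw [← le_div_iff₀' hz0] at hdisp
          refine hdisp.trans_eq ?_
          field_simp
      _ ≤ oddConst * (√(2 * Real.pi) * N * decayWeight z.re) := by
          have := oddConst_pos
          gcongr
      _ = C₂ * decayWeight z.re := by rw [hC₂]; ring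
      _ ≤ _ := by nlinarith

end Decay

/-! ### Pointwise inversion. -/

section Pointwise

lemma integrableOn_upperHalfPlane_re_mul_im {u v : ℝ → ℝ} (hu : Integrable u)
    (hv : IntegrableOn v (Set.Ioi 0)) :
    IntegrableOn (fun z : ℂ => u z.re * v z.im) {z : ℂ | 0 < z.im} := by
  have hv' : Integrable ((Set.Ioi 0).indicator v) := hv.integrable_indicator measurableSet_Ioi
  have h := Complex.volume_preserving_equiv_real_prod.integrable_comp_of_integrable
    (hu.mul_prod hv')
  rw [← integrable_indicator_iff measurableSet_upperHalfPlane]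
  refine h.congr (Eventually.of_forall fun z => ?_)
  by_cases hz : 0 < z.im
  · rw [Set.indicator_of_mem (show z ∈ {z : ℂ | 0 < z.im} from hz)]
    simp [Set.indicator_of_mem (show z.im ∈ Set.Ioi (0 : ℝ) from hz)]
  · rw [Set.indicator_of_notMem (show z ∉ {z : ℂ | 0 < z.im} from hz)]
    simp [Set.indicator_of_notMem (show z.im ∉ Set.Ioi (0 : ℝ) from hz)]

/-- A dominating function for the inversion integrand, uniform in bounded `p` with `p ^ 2 ≥ 2 k`. -/
noncomputable def inversionBound (k : ℝ) (z : ℂ) : ℝ :=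
  decayWeight z.re * (z.im ^ (-1 / 2 : ℝ) * Real.exp (-k * z.im))

lemma integrableOn_inversionBound {k : ℝ} (hk : 0 < k) :
    IntegrableOn (inversionBound k) {z : ℂ | 0 < z.im} := by
  have h := integrableOn_rpow_mul_exp_neg_mul_rpow (p := 1) (s := -1 / 2) (b := k)
    (by norm_num) one_pos hk
  simp only [Real.rpow_one] at h
  exact integrableOn_upperHalfPlane_re_mul_im integrable_decayWeight h

/-- The integrand of the inversion formula. -/
noncomputable def inversionIntegrand (f : ℂ → ℂ) (p : ℝ) (z : ℂ) : ℂ :=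
  waveKernel z p * (f z * ((z.im ^ (-1 / 2 : ℝ) : ℝ) : ℂ))

lemma continuous_inversionIntegrand (f : ℂ → ℂ) (z : ℂ) :
    Continuous fun p => inversionIntegrand f p z :=
  (continuous_waveKernel z).mul continuous_const

lemma aestronglyMeasurable_inversionIntegrand {f : ℂ → ℂ}
    (hf : ContinuousOn f {z : ℂ | 0 < z.im}) (p : ℝ) :
    AEStronglyMeasurable (inversionIntegrand f p) (volume.restrict {z : ℂ | 0 < z.im}) := by
  refine ContinuousOn.aestronglyMeasurable ?_ measurableSet_upperHalfPlane
  refine ContinuousOn.mul (continuous_waveKernel_uncurry.comp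
    (continuous_id.prodMk continuous_const)).continuousOn (hf.mul ?_)
  exact Complex.continuous_ofReal.comp_continuousOn
    (Complex.continuous_im.continuousOn.rpow_const fun z hz => Or.inl (ne_of_gt hz))

variable {f : ℂ → ℂ} {C : ℝ}
  (hbound : ∀ z : ℂ, 0 < z.im → ‖f z‖ ≤ C * decayWeight z.re)
include hbound

lemma norm_inversionIntegrand_le {p k M : ℝ} (hk : 2 * k ≤ p ^ 2) (hM : |p| ≤ M) {z : ℂ}
    (hz : 0 < z.im) :
    ‖inversionIntegrand f p z‖ ≤ oddConst * M * C * inversionBound k z := by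
  have h0 : 0 ≤ z.im ^ (-1 / 2 : ℝ) := Real.rpow_nonneg hz.le _
  have h1 : Real.exp (-(z.im / 2) * p ^ 2) ≤ Real.exp (-k * z.im) :=
    Real.exp_le_exp.2 (by nlinarith)
  have h2 : 0 ≤ decayWeight z.re := Real.rpow_nonneg (by positivity) _
  have h3 := oddConst_pos
  have h4 : 0 ≤ M := (abs_nonneg p).trans hM
  rw [inversionIntegrand, norm_mul, norm_mul, norm_waveKernel, Complex.norm_real,
    Real.norm_of_nonneg h0, inversionBound]
  calc oddConst * (|p| * Real.exp (-(z.im / 2) * p ^ 2)) * (‖f z‖ * z.im ^ (-1 / 2 : ℝ))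
      ≤ oddConst * (M * Real.exp (-k * z.im)) *
          ((C * decayWeight z.re) * z.im ^ (-1 / 2 : ℝ)) := by
        have := hbound z hz
        gcongr
    _ = _ := by ring

/-- For `p ≠ 0` the kernel decays like `exp(-a p² / 2)` in the height, which makes the full integral
absolutely convergent. -/
lemma tendsto_truncInverse_of_norm_le (hf : ContinuousOn f {z : ℂ | 0 < z.im}) {p : ℝ}
    (hp : p ≠ 0) :
    Tendsto (fun s : ℝ × ℝ => truncInverse f s.1 s.2 p) (atTop ×ˢ atTop)
      (𝓝 (∫ z in {z : ℂ | 0 < z.im}, inversionIntegrand f p z)) := by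
  have hp2 : 0 < p ^ 2 := by positivity
  have h := tendsto_integral_filter_of_dominated_convergence
    (μ := volume.restrict {z : ℂ | 0 < z.im}) (l := (atTop ×ˢ atTop : Filter (ℝ × ℝ)))
    (F := fun s => (truncRect s.1 s.2).indicator (inversionIntegrand f p))
    (f := inversionIntegrand f p)
    (fun z => oddConst * |p| * C * inversionBound (p ^ 2 / 2) z)
    (Eventually.of_forall fun s => (aestronglyMeasurable_inversionIntegrand hf p).indicator
      (measurableSet_truncRect _ _)) ?_
    ((integrableOn_inversionBound (half_pos hp2)).const_mul _) ?_
  · refine h.congr' ?_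
    have hpos : ∀ᶠ s : ℝ × ℝ in atTop ×ˢ atTop, 0 < s.2 :=
      tendsto_snd.eventually (eventually_gt_atTop _)
    filter_upwards [hpos] with s hs
    rw [setIntegral_indicator (measurableSet_truncRect _ _),
      Set.inter_eq_right.2 (truncRect_subset hs), truncInverse_eq]
    rfl
  · refine Eventually.of_forall fun s => ?_
    filter_upwards [ae_restrict_mem measurableSet_upperHalfPlane] with z hz
    exact (norm_indicator_le_norm_self _ _).trans
      (norm_inversionIntegrand_le hbound (by linarith) le_rfl hz)
  · filter_upwards [ae_restrict_mem measurableSet_upperHalfPlane] with z hz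
    refine tendsto_const_nhds.congr' ?_
    filter_upwards [eventually_mem_truncRect hz] with s hs
    rw [Set.indicator_of_mem hs]

lemma continuousOn_integral_inversionIntegrand (hf : ContinuousOn f {z : ℂ | 0 < z.im}) :
    ContinuousOn (fun p => ∫ z in {z : ℂ | 0 < z.im}, inversionIntegrand f p z) {0}ᶜ := by
  intro p hp
  have hp : p ≠ 0 := hp
  have hp2 : 0 < p ^ 2 := by positivity
  refine ContinuousAt.continuousWithinAt ?_
  refine continuousAt_of_dominated
    -- Near `p` one has `q² > p² / 2`, so `k = p² / 4` satisfies `2 k ≤ q²`.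
    (bound := fun z => oddConst * (|p| + 1) * C * inversionBound (p ^ 2 / 4) z)
    (Eventually.of_forall fun q => aestronglyMeasurable_inversionIntegrand hf q) ?_
    ((integrableOn_inversionBound (by positivity)).const_mul _)
    (Eventually.of_forall fun z => (continuous_inversionIntegrand f z).continuousAt)
  have h1 : ∀ᶠ q : ℝ in 𝓝 p, p ^ 2 / 2 < q ^ 2 :=
    ((continuous_pow 2).tendsto p).eventually (lt_mem_nhds (half_lt_self hp2))
  have h2 : ∀ᶠ q : ℝ in 𝓝 p, |q| < |p| + 1 :=
    (continuous_abs.tendsto p).eventually (gt_mem_nhds (lt_add_one _))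
  filter_upwards [h1, h2] with q h1 h2
  filter_upwards [ae_restrict_mem measurableSet_upperHalfPlane] with z hz
  exact norm_inversionIntegrand_le hbound (by linarith) h2.le hz

omit hbound

/-- The pointwise limit must agree with the `L²` limit `ψ`, since a subsequence of the truncations
converges to `ψ` almost everywhere. -/
lemma integral_inversionIntegrand_ae_eq (ψ : oddSchwartz)
    (hlim : ∀ p : ℝ, p ≠ 0 → Tendsto
      (fun s : ℝ × ℝ => truncInverse (oddTransform (ψ : 𝓢(ℝ, ℂ))) s.1 s.2 p) (atTop ×ˢ atTop)
      (𝓝 (∫ z in {z : ℂ | 0 < z.im}, inversionIntegrand (oddTransform (ψ : 𝓢(ℝ, ℂ))) p z))) :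
    (fun p => ∫ z in {z : ℂ | 0 < z.im}, inversionIntegrand (oddTransform (ψ : 𝓢(ℝ, ℂ))) p z)
      =ᵐ[volume] (ψ : 𝓢(ℝ, ℂ)) := by
  have hB := isBergman_oddTransform ψ
  have hsymm : oddTransformEquiv.symm hB.toSpace = oddSchwartzToL2 ψ := by
    rw [LinearIsometryEquiv.symm_apply_eq, oddTransformEquiv_oddSchwartzToL2]
  have hL2 := tendsto_eLpNorm_truncInverse_sub hB
  rw [hsymm] at hL2
  -- The second parameter is `n + 1` so that it is positive already at `n = 0`.
  have hseq : Tendsto (fun n : ℕ => ((n : ℝ), (n : ℝ) + 1)) atTop (atTop ×ˢ atTop) :=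
    tendsto_natCast_atTop_atTop.prodMk
      (tendsto_natCast_atTop_atTop.atTop_add tendsto_const_nhds)
  have hL2' : Tendsto (fun n : ℕ => eLpNorm (truncInverse (oddTransform (ψ : 𝓢(ℝ, ℂ))) n (n + 1) -
      ((oddSchwartzToL2 ψ : Lp ℂ 2 (volume : Measure ℝ)) : ℝ → ℂ)) 2 volume) atTop (𝓝 0) := by
    refine (hL2.comp hseq).congr fun n => ?_
    exact eLpNorm_congr_ae (Eventually.of_forall fun p => rfl)
  have hmeas : ∀ n : ℕ, AEStronglyMeasurable
      (truncInverse (oddTransform (ψ : 𝓢(ℝ, ℂ))) n (n + 1)) volume := fun n =>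
    (memLp_truncInverse hB n n.cast_add_one_pos).1
  obtain ⟨ns, hns, hae⟩ := (tendstoInMeasure_of_tendsto_eLpNorm two_ne_zero
    hmeas (Lp.memLp _).1 hL2').exists_seq_tendsto_ae
  filter_upwards [hae, (ψ : 𝓢(ℝ, ℂ)).coeFn_toLp 2 (volume : Measure ℝ),
    (Set.countable_singleton (0 : ℝ)).ae_notMem volume] with p h1 h2 h3
  have h2 : (oddSchwartzToL2 ψ : Lp ℂ 2 (volume : Measure ℝ)) p = (ψ : 𝓢(ℝ, ℂ)) p := h2
  rw [h2] at h1
  exact tendsto_nhds_unique ((hlim p h3).comp (hseq.comp hns.tendsto_atTop)) h1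

theorem tendsto_truncInverse_oddTransform (ψ : oddSchwartz) (p : ℝ) :
    Tendsto (fun s : ℝ × ℝ => truncInverse (oddTransform (ψ : 𝓢(ℝ, ℂ))) s.1 s.2 p)
      (atTop ×ˢ atTop) (𝓝 ((ψ : 𝓢(ℝ, ℂ)) p)) := by
  have hcont : ContinuousOn (oddTransform (ψ : 𝓢(ℝ, ℂ))) {z : ℂ | 0 < z.im} :=
    (isBergman_oddTransform ψ).1.continuousOn
  obtain ⟨C, hbound⟩ := exists_norm_oddTransform_le (ψ : 𝓢(ℝ, ℂ))
  have hlim := fun (p : ℝ) (hp : p ≠ 0) => tendsto_truncInverse_of_norm_le hbound hcont hp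
  -- At `p = 0` both sides vanish: the kernel carries a factor `p` and `ψ` is odd. Elsewhere two
  -- continuous functions that agree almost everywhere agree.
  by_cases hp : p = 0
  · have h0 : (ψ : 𝓢(ℝ, ℂ)) p = 0 := by
      have h := ψ.2 0
      rw [neg_zero] at h
      rw [hp]
      exact self_eq_neg.1 h
    rw [h0]
    simp only [truncInverse, hp, Complex.ofReal_zero, zero_mul, integral_zero, mul_zero]
    exact tendsto_const_nhds
  · have h := Measure.eqOn_open_of_ae_eq
      (μ := volume) (ae_restrict_of_ae (integral_inversionIntegrand_ae_eq ψ hlim))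
      (isOpen_compl_singleton (x := (0 : ℝ)))
      (continuousOn_integral_inversionIntegrand hbound hcont)
      (ψ : 𝓢(ℝ, ℂ)).continuous.continuousOn
    rw [← h hp]
    exact hlim p hp

end Pointwise

theorem mainTheorem1 :
    -- the transform maps odd Schwartz functions into `H_{-1/2}`
    (∀ ψ : oddSchwartz, IsBergman (-1 / 2) (oddTransform (ψ : 𝓢(ℝ, ℂ)))) ∧
    -- it preserves inner products
    (∀ φ ψ : oddSchwartz,
      ∫ z, oddTransform (φ : 𝓢(ℝ, ℂ)) z * conj (oddTransform (ψ : 𝓢(ℝ, ℂ)) z)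
          ∂(halfPlaneMeasure (-1 / 2)) =
        ∫ p : ℝ, (φ : 𝓢(ℝ, ℂ)) p * conj ((ψ : 𝓢(ℝ, ℂ)) p)) ∧
    -- it extends to a unitary map of the odd part of `L²(ℝ)` onto `H_{-1/2}`
    (∃ U : oddL2 ≃ₗᵢ[ℂ] bergmanSpace (-1 / 2),
      (∀ ψ : oddSchwartz,
        ((U (oddSchwartzToL2 ψ) : Lp ℂ 2 (halfPlaneMeasure (-1 / 2))) : ℂ → ℂ)
          =ᵐ[halfPlaneMeasure (-1 / 2)] oddTransform (ψ : 𝓢(ℝ, ℂ))) ∧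
      -- which is its only continuous linear extension
      (∀ V : oddL2 →L[ℂ] bergmanSpace (-1 / 2),
        (∀ ψ : oddSchwartz, V (oddSchwartzToL2 ψ) = U (oddSchwartzToL2 ψ)) → ∀ g : oddL2, V g = U g) ∧
      -- and whose inverse is the `L²` limit of the truncated integrals
      (∀ (f : ℂ → ℂ) (hf : IsBergman (-1 / 2) f),
        (∀ σ γ : ℝ, 0 < σ → 0 < γ → MemLp (truncInverse f σ γ) 2 volume) ∧
        Tendsto (fun s : ℝ × ℝ => eLpNorm (fun p : ℝ => truncInverse f s.1 s.2 p -
            ((U.symm hf.toSpace : Lp ℂ 2 (volume : Measure ℝ)) : ℝ → ℂ) p) 2 volume)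
          (atTop ×ˢ atTop) (𝓝 0))) ∧
    -- on transforms of odd Schwartz functions the inversion formula holds at every point
    (∀ (ψ : oddSchwartz) (p : ℝ),
      Tendsto (fun s : ℝ × ℝ => truncInverse (oddTransform (ψ : 𝓢(ℝ, ℂ))) s.1 s.2 p)
        (atTop ×ˢ atTop) (𝓝 ((ψ : 𝓢(ℝ, ℂ)) p))) := by
  refine ⟨isBergman_oddTransform, integral_oddTransform_mul_conj, ⟨oddTransformEquiv, ?_,
    eq_oddTransformEquiv_of_eq_on_oddSchwartz, fun f hf => ⟨fun σ γ _ hγ =>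
      memLp_truncInverse hf σ hγ, tendsto_eLpNorm_truncInverse_sub hf⟩⟩,
    tendsto_truncInverse_oddTransform⟩
  intro ψ
  rw [oddTransformEquiv_oddSchwartzToL2]
  exact (isBergman_oddTransform ψ).2.coeFn_toLp
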